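/- Let $d\ge 1$, $L>0$, $\varepsilon>0$, let $\mathbb T^d=(\mathbb R/L\mathbb Z)^d$ with Lebesgue measure $dx$ (total mass $L^d$), and let $F\in C^1(\mathbb T^d)$ and $f\in C(\mathbb T^d)$ with $f>0$. Put $$Z_G=\int_{\mathbb T^d}e^{-F/\varepsilon}dx,\qquad \pi_G=Z_G^{-1}e^{-F/\varepsilon},\qquad D_{\min}=\min_{\mathbb T^d}e^{F/\varepsilon},\qquad D_{\max}=\max_{\mathbb T^d}e^{F/\varepsilon}.$$ Consider the linear Fokker–Planck equation $$\partial_t\rho=\nabla\cdot\big(f\rho(\nabla F+\varepsilon\nabla\log\rho)\big)=\nabla\cdot\big(f(\rho\nabla F+\varepsilon\nabla\rho)\big)\quad\text{on }\mathbb T^d ,\tag{1}$$ which is the gradient flow of $\varepsilon\,\mathrm{KL}(\rho\|\pi_G)$ for the Wasserstein metric with weight $f\rho$. A global strong solution is a function $\rho$, continuous on $[0,\infty)\times\mathbb T^d$, such that $\rho(\cdot,0)\ge 0$, $\int\rho(x,0)\,dx=1$ and, for $t>0$, $\rho(\cdot,t)$ and the flux $f(\rho\nabla F+\varepsilon\nabla\rho)(\cdot,t)$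 are $C^1$ in $x$, $\partial_t\rho$ exists and is continuous on $(0,\infty)\times\mathbb T^d$, and (1) holds at every point. Let $C_{\mathrm{PI}}$ and $C_{\mathrm{LSI}}$ be the Poincaré and log-Sobolev constants of $\mathbb T^d$, that is, the best constants in $$\int v^2dx\le C_{\mathrm{PI}}\int|\nabla v|^2dx\quad\Big(v\in C^1(\mathbb T^d),\ \int v\,dx=0\Big),$$ $$\int v\log(L^d v)\,dx\le\frac{C_{\mathrm{LSI}}}2\int v|\nabla\log v|^2dx\quad\Big(0<v\in C^1(\mathbb T^d),\ \int v\,dx=1\Big),$$ and set $$\lambda_\varepsilon=\frac{\varepsilon D_{\min}^2}{D_{\max}}\min_{x\in\mathbb T^d}f(x)e^{-F(x)/\varepsilon},\qquad\lambda_1=\frac{\lambda_\varepsilon}{C_{\mathrm{PI}}},\qquad\lambda_2=\frac{\lambda_\varepsilon}{C_{\mathrm{LSI}}} .$$ Then $\lambda_1>0$ and $\lambda_2>0$; $\pi_G$ is the unique steady-state probability density of (1), that is, the only probability density that is, as a function constant in time, a strong solution; and every global strong solution $\rho$ of (1) satisfies, for all $t\ge0$, $$\chi^2(\rho(\cdot,t)\|\pi_G)\le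 e^{-2\lambda_1t}\,\chi^2(\rho(\cdot,0)\|\pi_G),$$ and, if $L\ge1$ (for example on the unit torus), $$\mathrm{KL}(\rho(\cdot,t)\|\pi_G)\le e^{-2\lambda_2t}\Big(2\lambda_2t\log(D_{\max}Z_G)+\mathrm{KL}(\rho(\cdot,0)\|\pi_G)\Big),$$ where $\chi^2(\rho\|\pi)=\int(\rho/\pi-1)^2\pi\,dx$ and $\mathrm{KL}(\rho\|\pi)=\int\rho\log(\rho/\pi)\,dx$. -/

import Mathlib

/-!
The torus of side `L` in dimension `d` is `ℝᵈ / (L ℤ)ᵈ`.  Functions on it are functions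
`(Fin d → ℝ) → ℝ` that are `L`-periodic in every coordinate, and integrals over it are Lebesgue
integrals over the period cell `[0, L]ᵈ`.
-/

noncomputable section

namespace FokkerPlanckTorus

variable {d : ℕ}

/-- The function `g` on `ℝᵈ` is `L`-periodic in every coordinate. -/
def IsPeriodic (L : ℝ) (g : (Fin d → ℝ) → ℝ) : Prop :=
  ∀ (i : Fin d) (x : Fin d → ℝ), g (x + Pi.single i L) = g x

/-- The integral over the torus of side `L` with respect to Lebesgue measure (total mass `L ^ d`). -/
def torusIntegral (L : ℝ) (g : (Fin d → ℝ) → ℝ) : ℝ :=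
  ∫ x in Set.Icc (0 : Fin d → ℝ) (fun _ => L), g x

/-- The partial derivative `∂ g / ∂ xᵢ`. -/
def pderiv (i : Fin d) (g : (Fin d → ℝ) → ℝ) (x : Fin d → ℝ) : ℝ :=
  fderiv ℝ g x (Pi.single i 1)

/-- The squared Euclidean length `|∇ g|²` of the gradient. -/
def gradSq (g : (Fin d → ℝ) → ℝ) (x : Fin d → ℝ) : ℝ :=
  ∑ i, pderiv i g x ^ 2

/-- The Poincaré inequality with constant `C` for Lebesgue measure on the torus of side `L`. -/
def PoincareInequality (d : ℕ) (L C : ℝ) : Prop :=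
  ∀ v : (Fin d → ℝ) → ℝ, ContDiff ℝ 1 v → IsPeriodic L v → torusIntegral L v = 0 →
    torusIntegral L (fun x => v x ^ 2) ≤ C * torusIntegral L (gradSq v)

/-- The Poincaré constant `C_PI` of the torus of side `L`: the best constant. -/
def poincareConst (d : ℕ) (L : ℝ) : ℝ :=
  sInf {C : ℝ | PoincareInequality d L C}

/-- The logarithmic Sobolev inequality with constant `C` for Lebesgue measure on the torus of side
`L`.  The left side is the entropy of the probability density `v` relative to the uniform
distribution, whose density is `1 / L ^ d`. -/
def LogSobolevInequality (d : ℕ) (L C : ℝ) : Prop :=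
  ∀ v : (Fin d → ℝ) → ℝ, ContDiff ℝ 1 v → IsPeriodic L v → (∀ x, 0 < v x) →
    torusIntegral L v = 1 →
    torusIntegral L (fun x => v x * Real.log (L ^ d * v x)) ≤
      C / 2 * torusIntegral L (fun x => v x * gradSq (fun y => Real.log (v y)) x)

/-- The log-Sobolev constant `C_LSI` of the torus of side `L`: the best constant. -/
def logSobolevConst (d : ℕ) (L : ℝ) : ℝ :=
  sInf {C : ℝ | LogSobolevInequality d L C}

/-- The normalizing constant `Z_G = ∫ exp (-F / ε)`. -/
def gibbsZ (L ε : ℝ) (F : (Fin d → ℝ) → ℝ) : ℝ :=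
  torusIntegral L (fun x => Real.exp (-(F x / ε)))

/-- The Gibbs density `π_G = Z_G⁻¹ exp (-F / ε)`. -/
def gibbs (L ε : ℝ) (F : (Fin d → ℝ) → ℝ) (x : Fin d → ℝ) : ℝ :=
  (gibbsZ L ε F)⁻¹ * Real.exp (-(F x / ε))

/-- `D_min`, the minimum of `exp (F / ε)` over the torus. -/
def Dmin (ε : ℝ) (F : (Fin d → ℝ) → ℝ) : ℝ := ⨅ x, Real.exp (F x / ε)

/-- `D_max`, the maximum of `exp (F / ε)` over the torus. -/
def Dmax (ε : ℝ) (F : (Fin d → ℝ) → ℝ) : ℝ := ⨆ x, Real.exp (F x / ε)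

/-- `λ_ε = ε D_min² / D_max · min (f exp (-F / ε))`. -/
def lambdaEps (ε : ℝ) (f F : (Fin d → ℝ) → ℝ) : ℝ :=
  ε * Dmin ε F ^ 2 / Dmax ε F * ⨅ x, f x * Real.exp (-(F x / ε))

/-- `λ₁ = λ_ε / C_PI`. -/
def lambda1 (L ε : ℝ) (f F : (Fin d → ℝ) → ℝ) : ℝ :=
  lambdaEps ε f F / poincareConst d L

/-- `λ₂ = λ_ε / C_LSI`. -/
def lambda2 (L ε : ℝ) (f F : (Fin d → ℝ) → ℝ) : ℝ :=
  lambdaEps ε f F / logSobolevConst d L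

/-- The divergence `χ²(p ‖ q) = ∫ (p / q - 1)² q` of densities. -/
def chiSq (L : ℝ) (p q : (Fin d → ℝ) → ℝ) : ℝ :=
  torusIntegral L (fun x => (p x / q x - 1) ^ 2 * q x)

/-- The divergence `KL(p ‖ q) = ∫ p log (p / q)` of densities. -/
def KL (L : ℝ) (p q : (Fin d → ℝ) → ℝ) : ℝ :=
  torusIntegral L (fun x => p x * Real.log (p x / q x))

/-- The `i`-th component of `f p (∇F + ε ∇ log p) = f (p ∇F + ε ∇p)`.  The right-hand side also
makes sense where `p` vanishes. -/
def flux (ε : ℝ) (f F p : (Fin d → ℝ) → ℝ) (i : Fin d) (x : Fin d → ℝ) : ℝ :=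
  f x * (p x * pderiv i F x + ε * pderiv i p x)

/-- `ρ` is a global strong solution, on the torus of side `L`, of
`∂ₜ ρ = ∇ · (f ρ (∇F + ε ∇ log ρ))` that starts from a probability density: it is continuous up to
`t = 0`, and for `t > 0` the density and its flux are `C¹` in space, `∂ₜ ρ` exists and is
continuous, and the equation holds at every point. -/
structure IsStrongSolution (L ε : ℝ) (f F : (Fin d → ℝ) → ℝ)
    (ρ : ℝ → (Fin d → ℝ) → ℝ) : Prop where
  periodic : ∀ t, 0 ≤ t → IsPeriodic L (ρ t)
  init_nonneg : ∀ x, 0 ≤ ρ 0 x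
  init_mass : torusIntegral L (ρ 0) = 1
  continuousOn : ContinuousOn (fun p : ℝ × (Fin d → ℝ) => ρ p.1 p.2) (Set.Ici 0 ×ˢ Set.univ)
  contDiff_space : ∀ t, 0 < t → ContDiff ℝ 1 (ρ t)
  contDiff_flux : ∀ t, 0 < t → ∀ i, ContDiff ℝ 1 (flux ε f F (ρ t) i)
  continuousOn_time_deriv :
    ContinuousOn (fun p : ℝ × (Fin d → ℝ) => deriv (fun s => ρ s p.2) p.1)
      (Set.Ioi 0 ×ˢ Set.univ)
  equation : ∀ t, 0 < t → ∀ x,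
    HasDerivAt (fun s => ρ s x) (∑ i, pderiv i (flux ε f F (ρ t) i) x) t

/-- `p` is a steady-state distribution of the equation: a probability density that, taken as
constant in time, solves it. -/
def IsSteadyState (L ε : ℝ) (f F p : (Fin d → ℝ) → ℝ) : Prop :=
  IsStrongSolution L ε f F (fun _ => p)

end FokkerPlanckTorus

end

noncomputable section

namespace FokkerPlanckTorus

open MeasureTheory Set Filter Topology

variable {d : ℕ} {L : ℝ} {g h : (Fin d → ℝ) → ℝ}

/-! ### The integral over the period cell -/

/-! Put `w = exp (-F / ε)` and `h = ρ / w`. The flux is then `ε f w ∇h` (`flux_eq`), so integration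
by parts on the torus gives, for suitable `φ`, the dissipation identity `d/dt ∫ w φ(h) = -∫ φ''(h) ε
f w |∇h|²` (`hasDerivAt_functional`). Quadratic `φ` yields χ², `φ(y) = y log (Z y)` yields KL, and
`φ = id` yields conservation of mass.

Decay follows by bounding the functional by its dissipation. The Poincaré and log-Sobolev
inequalities for Lebesgue measure pass to the weight `w` by the Holley–Stroock perturbation argument
(`weighted_poincare`, `weighted_logSobolev`), at the cost of a factor `W = 1 / D_min ≥ w`. Since
`λ_ε W ≤ ε f w`, Grönwall gives the rates `2 λ₁` and `2 λ₂`.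

The solution may vanish, so the logarithm needs care. Nonnegativity for all times comes from a
smoothed negative part (`relDensity_nonneg`); entropy decay is proved for `h + δ` and then `δ → 0`.
This gives the KL decay without the extra term in the statement, which is nonnegative when `L ≥ 1`.

The best constants are infima, so they are meaningful only if some constant works and the admissible
ones are bounded below by a positive number. A log-Sobolev inequality with constant `2 L²` comes
from a one-dimensional estimate and tensorization (`entropy_le_sum_fisher`); it implies a Poincaré
inequality by perturbing the constant density. A sine wave bounds the constants below.

For uniqueness, the χ² of a steady state contracts strictly although it is constant in time, hence
is zero. -/

theorem integrableOn_cell (hg : Continuous g) :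
    IntegrableOn g (Icc (0 : Fin d → ℝ) (fun _ => L)) :=
  hg.integrableOn_Icc

theorem torusIntegral_add (hg : Continuous g) (hh : Continuous h) :
    torusIntegral L (fun x => g x + h x) = torusIntegral L g + torusIntegral L h :=
  integral_add (integrableOn_cell hg) (integrableOn_cell hh)

theorem torusIntegral_sub (hg : Continuous g) (hh : Continuous h) :
    torusIntegral L (fun x => g x - h x) = torusIntegral L g - torusIntegral L h :=
  integral_sub (integrableOn_cell hg) (integrableOn_cell hh)

theorem torusIntegral_const_mul (c : ℝ) (g : (Fin d → ℝ) → ℝ) :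
    torusIntegral L (fun x => c * g x) = c * torusIntegral L g :=
  integral_const_mul _ _

theorem torusIntegral_mul_const (g : (Fin d → ℝ) → ℝ) (c : ℝ) :
    torusIntegral L (fun x => g x * c) = torusIntegral L g * c :=
  integral_mul_const _ _

theorem torusIntegral_sum {ι : Type*} (s : Finset ι) {G : ι → (Fin d → ℝ) → ℝ}
    (hG : ∀ i, Continuous (G i)) :
    torusIntegral L (fun x => ∑ i ∈ s, G i x) = ∑ i ∈ s, torusIntegral L (G i) :=
  integral_finsetSum _ fun i _ => integrableOn_cell (hG i)

theorem torusIntegral_mono (hg : Continuous g) (hh : Continuous h) (hgh : ∀ x, g x ≤ h x) :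
    torusIntegral L g ≤ torusIntegral L h :=
  integral_mono (integrableOn_cell hg) (integrableOn_cell hh) hgh

theorem torusIntegral_nonneg (hg : ∀ x, 0 ≤ g x) : 0 ≤ torusIntegral L g :=
  integral_nonneg hg

theorem torusIntegral_const (hL : 0 < L) (c : ℝ) :
    torusIntegral L (fun _ : Fin d → ℝ => c) = L ^ d * c := by
  have hle : (0 : Fin d → ℝ) ≤ fun _ => L := fun _ => hL.le
  simp [torusIntegral, Measure.real, Real.volume_Icc_pi, ENNReal.toReal_ofReal hL.le]

theorem eq_zero_on_cell_of_torusIntegral_eq_zero (hL : 0 < L) (hg : Continuous g)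
    (hg0 : ∀ x, 0 ≤ g x) (hint : torusIntegral L g = 0) :
    ∀ x ∈ Icc (0 : Fin d → ℝ) (fun _ => L), g x = 0 := by
  have hae : g =ᵐ[volume.restrict (Icc (0 : Fin d → ℝ) (fun _ => L))] 0 :=
    (integral_eq_zero_iff_of_nonneg hg0 (integrableOn_cell hg)).1 hint
  set U : Set (Fin d → ℝ) := pi univ fun _ => Ioo 0 L
  have hUopen : IsOpen U := isOpen_set_pi finite_univ fun _ _ => isOpen_Ioo
  have hUsub : U ⊆ Icc (0 : Fin d → ℝ) (fun _ => L) := fun x hx =>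
    ⟨fun i => (hx i trivial).1.le, fun i => (hx i trivial).2.le⟩
  -- On the open cell a.e. vanishing of a continuous function is vanishing everywhere; the boundary
  -- follows by closure.
  have hU : EqOn g 0 U :=
    Measure.eqOn_open_of_ae_eq (ae_restrict_of_ae_restrict_of_subset hUsub hae) hUopen
      hg.continuousOn continuousOn_const
  have hcl : EqOn g 0 (closure U) := hU.closure hg continuous_const
  intro x hx
  refine hcl ?_
  rw [closure_pi_set]
  intro i _
  rw [closure_Ioo hL.ne]
  exact ⟨hx.1 i, hx.2 i⟩

/-! ### Periodic functions -/

theorem apply_add_eq_of_forall_single {X : Type*} {G : (Fin d → ℝ) → X} (c : Fin d → ℝ)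
    (hG : ∀ i x, G (x + Pi.single i (c i)) = G x) (x : Fin d → ℝ) : G (x + c) = G x := by
  have key : ∀ s : Finset (Fin d), ∀ x, G (x + ∑ i ∈ s, Pi.single i (c i)) = G x := by
    intro s
    induction s using Finset.induction_on with
    | empty => simp
    | insert i s hi ih =>
      intro x
      rw [Finset.sum_insert hi, ← add_assoc, ih, hG]
  simpa [Finset.univ_sum_single] using key Finset.univ x

theorem IsPeriodic.line (hg : IsPeriodic L g) (i : Fin d) (x : Fin d → ℝ) :
    Function.Periodic (fun s : ℝ => g (x + Pi.single i s)) L := by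
  intro s
  simp only [Pi.single_add, ← add_assoc]
  exact hg i _

theorem IsPeriodic.exists_mem_cell (hL : 0 < L) (hg : IsPeriodic L g) (x : Fin d → ℝ) :
    ∃ y ∈ Icc (0 : Fin d → ℝ) (fun _ => L), g y = g x := by
  set c : Fin d → ℝ := fun i => -(⌊x i / L⌋ : ℝ) * L
  refine ⟨x + c, ⟨fun i => ?_, fun i => ?_⟩, apply_add_eq_of_forall_single c (fun i x => ?_) x⟩
  · have := Int.floor_le (x i / L)
    rw [le_div_iff₀ hL] at this
    simp only [c, Pi.add_apply, Pi.zero_apply]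
    linarith
  · have := Int.lt_floor_add_one (x i / L)
    rw [div_lt_iff₀ hL] at this
    simp only [c, Pi.add_apply]
    linarith
  · simpa [c] using (hg.line i x).int_mul (-⌊_⌋) 0

theorem IsPeriodic.exists_forall_le (hL : 0 < L) (hg : IsPeriodic L g) (hc : Continuous g) :
    ∃ y, ∀ x, g y ≤ g x := by
  obtain ⟨y, -, hy⟩ := (isCompact_Icc (a := (0 : Fin d → ℝ)) (b := fun _ => L)).exists_isMinOn
    ⟨0, le_rfl, fun _ => hL.le⟩ hc.continuousOn
  refine ⟨y, fun x => ?_⟩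
  obtain ⟨z, hz, hzx⟩ := hg.exists_mem_cell hL x
  exact hzx ▸ hy hz

theorem IsPeriodic.comp (hg : IsPeriodic L g) (φ : ℝ → ℝ) : IsPeriodic L (fun x => φ (g x)) :=
  fun i x => congrArg φ (hg i x)

theorem IsPeriodic.mul (hg : IsPeriodic L g) (hh : IsPeriodic L h) :
    IsPeriodic L (fun x => g x * h x) := fun i x => by simp only [hg i x, hh i x]

theorem IsPeriodic.pderiv (hg : IsPeriodic L g) (j : Fin d) : IsPeriodic L (pderiv j g) := by
  intro i x
  have : (fun y => g (y + Pi.single i L)) = g := funext (hg i)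
  unfold FokkerPlanckTorus.pderiv
  rw [← fderiv_comp_add_right, this]

theorem IsPeriodic.exists_abs_le (hL : 0 < L) (hg : IsPeriodic L g) (hc : Continuous g) :
    ∃ K, ∀ x, |g x| ≤ K := by
  obtain ⟨y, hy⟩ := (hg.comp fun r => -|r|).exists_forall_le hL (by fun_prop)
  exact ⟨|g y|, fun x => by simpa using hy x⟩

/-! ### Partial derivatives -/

theorem continuous_pderiv (hg : ContDiff ℝ 1 g) (i : Fin d) : Continuous (pderiv i g) :=
  (hg.continuous_fderiv one_ne_zero).clm_apply continuous_const

theorem hasDerivAt_line (hg : Differentiable ℝ g) (i : Fin d) (x : Fin d → ℝ) (s : ℝ) :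
    HasDerivAt (fun s : ℝ => g (x + Pi.single i s)) (pderiv i g (x + Pi.single i s)) s := by
  have h1 : HasDerivAt (fun s : ℝ => x + Pi.single i s) (Pi.single i (1 : ℝ)) s :=
    (hasDerivAt_single i s).const_add x
  exact (hg _).hasFDerivAt.comp_hasDerivAt s h1

theorem pderiv_mul (hg : Differentiable ℝ g) (hh : Differentiable ℝ h) (i : Fin d)
    (x : Fin d → ℝ) :
    pderiv i (fun y => g y * h y) x = pderiv i g x * h x + g x * pderiv i h x := by
  unfold pderiv
  rw [fderiv_fun_mul (hg x) (hh x)]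
  simp
  ring

theorem pderiv_comp {φ : ℝ → ℝ} {φ' : ℝ} {x : Fin d → ℝ} (hφ : HasDerivAt φ φ' (g x))
    (hg : Differentiable ℝ g) (i : Fin d) :
    pderiv i (fun y => φ (g y)) x = φ' * pderiv i g x := by
  unfold pderiv
  have := hφ.comp_hasFDerivAt x (hg x).hasFDerivAt
  rw [HasFDerivAt.fderiv (f := fun y => φ (g y)) this]
  simp

/-! ### Averaging along a coordinate -/

/-- The mean of `g` along the `k`-th coordinate circle through a point. -/
def coordAvg (L : ℝ) (k : Fin d) (g : (Fin d → ℝ) → ℝ) (x : Fin d → ℝ) : ℝ :=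
  L⁻¹ * ∫ s in (0 : ℝ)..L, g (x + Pi.single k s)

theorem continuous_coordLine (k : Fin d) :
    Continuous fun s : ℝ => (Pi.single k s : Fin d → ℝ) :=
  continuous_single (A := fun _ : Fin d => ℝ) k

theorem continuous_line (hg : Continuous g) (k : Fin d) (x : Fin d → ℝ) :
    Continuous fun s : ℝ => g (x + Pi.single k s) :=
  hg.comp (continuous_const.add (continuous_coordLine k))

theorem continuous_coordAvg (hg : Continuous g) (k : Fin d) : Continuous (coordAvg L k g) := by
  unfold coordAvg
  refine continuous_const.mul ?_
  refine intervalIntegral.continuous_parametric_intervalIntegral_of_continuous' ?_ _ _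
  exact hg.comp (continuous_fst.add ((continuous_coordLine k).comp continuous_snd))

theorem IsPeriodic.coordAvg (hg : IsPeriodic L g) (k : Fin d) :
    IsPeriodic L (coordAvg L k g) := by
  intro i x
  unfold FokkerPlanckTorus.coordAvg
  congr 2 with s
  rw [add_right_comm, hg]

theorem coordAvg_add_single_self (hg : IsPeriodic L g) (k : Fin d) (x : Fin d → ℝ) (r : ℝ) :
    coordAvg L k g (x + Pi.single k r) = coordAvg L k g x := by
  unfold coordAvg
  congr 1
  have h1 := intervalIntegral.integral_comp_add_left (a := 0) (b := L)
    (fun s => g (x + Pi.single k s)) r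
  simp only [Pi.single_add, ← add_assoc] at h1
  rw [h1, add_zero, (hg.line k x).intervalIntegral_add_eq r 0, zero_add]

/-- `coordAvg` acts as the conditional expectation given the other coordinates; this is its pull-out
property. -/
theorem coordAvg_mul_left {c : (Fin d → ℝ) → ℝ} (k : Fin d) (x : Fin d → ℝ)
    (hc : ∀ r, c (x + Pi.single k r) = c x) :
    coordAvg L k (fun y => c y * g y) x = c x * coordAvg L k g x := by
  unfold coordAvg
  simp only [hc, intervalIntegral.integral_const_mul]
  ring

theorem coordAvg_mono (hL : 0 < L) (hg : Continuous g) (hh : Continuous h) (k : Fin d)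
    (x : Fin d → ℝ) (hgh : ∀ y, g y ≤ h y) : coordAvg L k g x ≤ coordAvg L k h x := by
  unfold coordAvg
  gcongr
  exact intervalIntegral.integral_mono_on hL.le
    ((continuous_line hg k x).intervalIntegrable _ _)
    ((continuous_line hh k x).intervalIntegrable _ _) fun s _ => hgh _

theorem coordAvg_sub (hg : Continuous g) (hh : Continuous h) (k : Fin d) (x : Fin d → ℝ) :
    coordAvg L k (fun y => g y - h y) x = coordAvg L k g x - coordAvg L k h x := by
  unfold coordAvg
  rw [intervalIntegral.integral_sub ((continuous_line hg k x).intervalIntegrable _ _)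
    ((continuous_line hh k x).intervalIntegrable _ _), mul_sub]

theorem coordAvg_pos (hL : 0 < L) (hg : Continuous g) (hpos : ∀ y, 0 < g y) (k : Fin d)
    (x : Fin d → ℝ) : 0 < coordAvg L k g x := by
  refine mul_pos (inv_pos.2 hL) ?_
  exact intervalIntegral.intervalIntegral_pos_of_pos
    ((continuous_line hg k x).intervalIntegrable _ _) (fun s => hpos _) hL

theorem coordAvg_pderiv_self (hg : ContDiff ℝ 1 g) (hper : IsPeriodic L g) (k : Fin d)
    (x : Fin d → ℝ) : coordAvg L k (pderiv k g) x = 0 := by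
  unfold coordAvg
  rw [intervalIntegral.integral_eq_sub_of_hasDerivAt
    (fun s _ => hasDerivAt_line (hg.differentiable one_ne_zero) k x s)
    ((continuous_line (continuous_pderiv hg k) k x).intervalIntegrable _ _), hper]
  simp

theorem hasFDerivAt_coordAvg (hg : ContDiff ℝ 1 g) (k : Fin d) (x : Fin d → ℝ) :
    HasFDerivAt (coordAvg L k g)
      (L⁻¹ • ∫ s in (0 : ℝ)..L, fderiv ℝ g (x + Pi.single k s)) x := by
  have hc : Continuous (Function.uncurry fun (y : Fin d → ℝ) (s : ℝ) =>
      fderiv ℝ g (y + Pi.single k s)) :=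
    (hg.continuous_fderiv one_ne_zero).comp
      (continuous_fst.add ((continuous_coordLine k).comp continuous_snd))
  obtain ⟨K, hK⟩ := ((isCompact_closedBall x 1).prod
    (isCompact_uIcc (a := (0 : ℝ)) (b := L))).bddAbove_image hc.norm.continuousOn
  suffices HasFDerivAt (fun y => ∫ s in (0 : ℝ)..L, g (y + Pi.single k s))
      (∫ s in (0 : ℝ)..L, fderiv ℝ g (x + Pi.single k s)) x from this.const_smul L⁻¹
  refine intervalIntegral.hasFDerivAt_integral_of_dominated_of_fderiv_le
    (𝕜 := ℝ) (F' := fun y s => fderiv ℝ g (y + Pi.single k s))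
    (bound := fun _ => K) (Metric.closedBall_mem_nhds x one_pos) ?_ ?_ ?_ ?_ ?_ ?_
  · exact Eventually.of_forall fun y =>
      (continuous_line hg.continuous k y).aestronglyMeasurable
  · exact (continuous_line hg.continuous k x).intervalIntegrable _ _
  · exact (hc.comp (Continuous.prodMk_right x)).aestronglyMeasurable
  · exact Eventually.of_forall fun s hs y hy => hK ⟨(y, s), ⟨hy, uIoc_subset_uIcc hs⟩, rfl⟩
  · exact intervalIntegrable_const
  · refine Eventually.of_forall fun s _ y _ => ?_
    exact (hasFDerivAt_comp_add_right _).2 ((hg.differentiable one_ne_zero) _).hasFDerivAt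

theorem contDiff_coordAvg (hg : ContDiff ℝ 1 g) (k : Fin d) :
    ContDiff ℝ 1 (coordAvg L k g) := by
  rw [contDiff_one_iff_fderiv]
  refine ⟨fun x => (hasFDerivAt_coordAvg hg k x).differentiableAt, ?_⟩
  rw [funext fun x => (hasFDerivAt_coordAvg (L := L) hg k x).fderiv]
  refine Continuous.const_smul (M := ℝ) ?_ L⁻¹
  refine intervalIntegral.continuous_parametric_intervalIntegral_of_continuous' ?_ _ _
  exact (hg.continuous_fderiv one_ne_zero).comp
      (continuous_fst.add ((continuous_coordLine k).comp continuous_snd))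

theorem pderiv_coordAvg (hg : ContDiff ℝ 1 g) (k j : Fin d) (x : Fin d → ℝ) :
    pderiv j (coordAvg L k g) x = coordAvg L k (pderiv j g) x := by
  unfold pderiv
  rw [(hasFDerivAt_coordAvg hg k x).fderiv]
  have hc : Continuous fun s : ℝ => fderiv ℝ g (x + Pi.single k s) :=
    (hg.continuous_fderiv one_ne_zero).comp (continuous_const.add (continuous_coordLine k))
  simp only [FunLike.coe_smul, Pi.smul_apply, smul_eq_mul, coordAvg]
  rw [ContinuousLinearMap.intervalIntegral_apply (hc.intervalIntegrable _ _)]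

/-! ### Fubini in one coordinate and integration by parts on the torus. -/

theorem torusIntegral_eq_iterated {n : ℕ} (hL : 0 < L) {g : (Fin (n + 1) → ℝ) → ℝ}
    (hg : Continuous g) (k : Fin (n + 1)) :
    torusIntegral L g = ∫ y in Icc (0 : Fin n → ℝ) (fun _ => L),
      ∫ s in (0 : ℝ)..L, g (k.insertNth s y) := by
  set e : ℝ × (Fin n → ℝ) ≃ᵐ (Fin (n + 1) → ℝ) :=
    (MeasurableEquiv.piFinSuccAbove (fun _ => ℝ) k).symm
  have hem : MeasurePreserving e :=
    (volume_preserving_piFinSuccAbove (fun _ : Fin (n + 1) => ℝ) k).symm _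
  have heπ : (e ⁻¹' Icc 0 fun _ => L) = Icc 0 L ×ˢ Icc (0 : Fin n → ℝ) fun _ => L :=
    ((Fin.insertNthOrderIso (fun _ => ℝ) k).preimage_Icc _ _).trans (Icc_prod_eq _ _)
  have hint : IntegrableOn (fun p => g (e p)) (Icc 0 L ×ˢ Icc (0 : Fin n → ℝ) fun _ => L)
      (volume.prod volume) := by
    have := integrableOn_cell (L := L) hg
    rwa [← hem.integrableOn_comp_preimage e.measurableEmbedding, heπ] at this
  rw [torusIntegral, ← hem.map_eq, setIntegral_map_equiv, heπ, Measure.volume_eq_prod]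
  rw [← Measure.prod_restrict, integral_prod_symm _ (by rwa [Measure.prod_restrict])]
  refine setIntegral_congr_fun measurableSet_Icc fun y _ => ?_
  rw [intervalIntegral.integral_of_le hL.le, integral_Icc_eq_integral_Ioc]
  rfl

theorem torusIntegral_coordAvg (hL : 0 < L) (hg : Continuous g) (hper : IsPeriodic L g)
    (k : Fin d) : torusIntegral L (coordAvg L k g) = torusIntegral L g := by
  obtain _ | n := d
  · exact k.elim0
  rw [torusIntegral_eq_iterated hL (continuous_coordAvg hg k) k,
    torusIntegral_eq_iterated hL hg k]
  refine setIntegral_congr_fun measurableSet_Icc fun y _ => ?_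
  have hins : ∀ s : ℝ, (k.insertNth s y : Fin (n + 1) → ℝ) =
      k.insertNth 0 y + Pi.single k s := by
    intro s
    funext i
    refine Fin.succAboveCases k ?_ (fun j => ?_) i <;> simp [Fin.succAbove_ne]
  have h1 : ∀ s : ℝ, coordAvg L k g (k.insertNth s y) = coordAvg L k g (k.insertNth 0 y) :=
    fun s => by rw [hins, coordAvg_add_single_self hper]
  simp only [h1, intervalIntegral.integral_const, sub_zero, smul_eq_mul]
  rw [coordAvg, ← mul_assoc, mul_inv_cancel₀ hL.ne', one_mul]
  simp only [← hins]

/-- Already the average over each `k`-circle vanishes, by the fundamental theorem of calculus and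
periodicity. -/
theorem torusIntegral_pderiv (hL : 0 < L) (hg : ContDiff ℝ 1 g) (hper : IsPeriodic L g)
    (k : Fin d) : torusIntegral L (pderiv k g) = 0 := by
  rw [← torusIntegral_coordAvg hL (continuous_pderiv hg k) (hper.pderiv k) k,
    funext (coordAvg_pderiv_self hg hper k)]
  simp [torusIntegral]

theorem torusIntegral_mul_pderiv (hL : 0 < L) (hg : ContDiff ℝ 1 g) (hper : IsPeriodic L g)
    (hh : ContDiff ℝ 1 h) (hhper : IsPeriodic L h) (k : Fin d) :
    torusIntegral L (fun x => g x * pderiv k h x) =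
      -torusIntegral L (fun x => pderiv k g x * h x) := by
  have h0 := torusIntegral_pderiv hL (hg.mul hh) (hper.mul hhper) k
  rw [funext (pderiv_mul (hg.differentiable one_ne_zero) (hh.differentiable one_ne_zero) k),
    torusIntegral_add (g := fun x => pderiv k g x * h x) (h := fun x => g x * pderiv k h x)
      ((continuous_pderiv hg k).mul hh.continuous)
      (hg.continuous.mul (continuous_pderiv hh k))] at h0
  linarith

/-! ### The relative entropy integrand -/

/-- This is the Bregman divergence of `y log y`. Its sign shows that the mean is the optimal
reference point for an entropy, and permits pointwise comparison of weights. -/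
theorem entropyIntegrand_nonneg {x M : ℝ} (hx : 0 < x) (hM : 0 < M) :
    0 ≤ x * Real.log (x / M) - x + M := by
  have h1 := Real.one_sub_inv_le_log_of_pos (div_pos hx hM)
  have h2 := mul_le_mul_of_nonneg_left h1 hx.le
  have h3 : x * (1 - (x / M)⁻¹) = x - M := by field_simp
  linarith

/-- By `log r ≤ r - 1` the left side is at most `(x - M)² / M = (√x - √M)² (√x + √M)² / M`, and `√x
≤ √M` bounds the last factor by 4. -/
theorem entropyIntegrand_le_of_le {x M : ℝ} (hx : 0 < x) (hxM : x ≤ M) :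
    x * Real.log (x / M) - x + M ≤ 4 * (√x - √M) ^ 2 := by
  have hM : 0 < M := hx.trans_le hxM
  have h1 := Real.log_le_sub_one_of_pos (div_pos hx hM)
  have h2 := mul_le_mul_of_nonneg_left h1 hx.le
  have ha := Real.sqrt_pos.2 hx
  have hb := Real.sqrt_pos.2 hM
  have hab := Real.sqrt_le_sqrt hxM
  have hxa : x = √x ^ 2 := (Real.sq_sqrt hx.le).symm
  have hMb : M = √M ^ 2 := (Real.sq_sqrt hM.le).symm
  have h3 : x * (x / M - 1) - x + M = (√x - √M) ^ 2 * ((√x + √M) ^ 2 / √M ^ 2) := by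
    rw [← hMb]
    field_simp
    nlinarith [hxa, hMb]
  have h4 : (√x + √M) ^ 2 / √M ^ 2 ≤ 4 := by
    rw [div_le_iff₀ (by positivity)]
    nlinarith
  have h5 := mul_le_mul_of_nonneg_left h4 (sq_nonneg (√x - √M))
  linarith

/-- Writing `log x = 2 log √x ≥ 2 (1 - 1/√x)` bounds the right side below by `(√x - 1)² = (x - 1)² /
(√x + 1)²`; the 9 is `(√4 + 1)²`. -/
theorem sq_sub_one_le_entropyIntegrand {x : ℝ} (hx : 0 < x) (hx4 : x ≤ 4) :
    (x - 1) ^ 2 / 9 ≤ x * Real.log x - x + 1 := by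
  have ha := Real.sqrt_pos.2 hx
  have hxa : √x ^ 2 = x := Real.sq_sqrt hx.le
  have h2 : √x ≤ 2 := by
    rw [Real.sqrt_le_left (by norm_num)]
    linarith
  have h1 := Real.one_sub_inv_le_log_of_pos ha
  have hlog : Real.log x = 2 * Real.log √x := by
    conv_lhs => rw [← hxa, Real.log_pow]
    norm_num
  have h4 := mul_le_mul_of_nonneg_left h1 (sq_nonneg √x)
  have h5 : √x ^ 2 * (1 - (√x)⁻¹) = √x ^ 2 - √x := by field_simp
  rw [h5, hxa] at h4
  have h6 : (x - 1) ^ 2 = (√x - 1) ^ 2 * (√x + 1) ^ 2 := by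
    rw [← mul_pow]
    congr 1
    nlinarith
  have h7 : (√x + 1) ^ 2 ≤ 9 := by nlinarith
  have h8 := mul_le_mul_of_nonneg_left h7 (sq_nonneg (√x - 1))
  rw [hlog]
  nlinarith

/-! ### The logarithmic Sobolev inequality on an interval -/

theorem sub_le_integral_abs_deriv {r r' : ℝ → ℝ} (hr : ∀ s, HasDerivAt r (r' s) s)
    (hr' : Continuous r') {a b : ℝ} (ha : 0 ≤ a) (hab : a ≤ b) (hb : b ≤ L) :
    |r b - r a| ≤ ∫ s in (0 : ℝ)..L, |r' s| := by
  rw [← intervalIntegral.integral_eq_sub_of_hasDerivAt (fun s _ => hr s)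
    (hr'.intervalIntegrable _ _)]
  refine (intervalIntegral.abs_integral_le_integral_abs hab).trans ?_
  exact intervalIntegral.integral_mono_interval ha hab hb
    (Eventually.of_forall fun s => abs_nonneg _) (hr'.abs.intervalIntegrable _ _)

/-- Cauchy–Schwarz, read off from the nonnegativity of the variance. -/
theorem sq_integral_le {r : ℝ → ℝ} (hL : 0 < L) (hr : Continuous r) :
    (∫ s in (0 : ℝ)..L, r s) ^ 2 ≤ L * ∫ s in (0 : ℝ)..L, r s ^ 2 := by
  set B := ∫ s in (0 : ℝ)..L, r s with hB
  have h0 : 0 ≤ ∫ s in (0 : ℝ)..L, (r s - B / L) ^ 2 :=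
    intervalIntegral.integral_nonneg hL.le fun s _ => sq_nonneg _
  have h1 : ∫ s in (0 : ℝ)..L, (r s - B / L) ^ 2 =
      (∫ s in (0 : ℝ)..L, r s ^ 2) - 2 * (B / L) * B + L * (B / L) ^ 2 := by
    have he : ∀ s, (r s - B / L) ^ 2 = r s ^ 2 - 2 * (B / L) * r s + (B / L) ^ 2 :=
      fun s => by ring
    simp only [he]
    rw [intervalIntegral.integral_add, intervalIntegral.integral_sub,
      intervalIntegral.integral_const_mul, intervalIntegral.integral_const, ← hB]
    · simp
    all_goals exact Continuous.intervalIntegrable (by fun_prop) _ _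
  rw [h1] at h0
  have h2 : L * ((∫ s in (0 : ℝ)..L, r s ^ 2) - 2 * (B / L) * B + L * (B / L) ^ 2) =
      L * (∫ s in (0 : ℝ)..L, r s ^ 2) - B ^ 2 := by
    field_simp
    ring
  have h3 := mul_nonneg hL.le h0
  linarith

/-- Replacing the mean `m` by the maximum `M` only increases the Bregman form of the entropy. That
form is at most `4 (√q - √M)²`, and the oscillation of `√q` is at most `∫ |(√q)'|`, which
Cauchy–Schwarz controls by `∫ q'² / (4 q)`. -/
theorem integral_mul_log_div_mean_le {q q' : ℝ → ℝ} (hL : 0 < L)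
    (hq : ∀ s, HasDerivAt q (q' s) s) (hq' : Continuous q') (hpos : ∀ s, 0 < q s) {m : ℝ}
    (hm : m = L⁻¹ * ∫ s in (0 : ℝ)..L, q s) :
    ∫ s in (0 : ℝ)..L, q s * Real.log (q s / m) ≤
      L ^ 2 * ∫ s in (0 : ℝ)..L, q' s ^ 2 / q s := by
  have hqc : Continuous q := continuous_iff_continuousAt.2 fun s => (hq s).continuousAt
  have hqlog : Continuous fun s => Real.log (q s) := hqc.log fun s => (hpos s).ne'
  have hint : ∫ s in (0 : ℝ)..L, q s = L * m := by rw [hm]; field_simp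
  have hmpos : 0 < m := by
    rw [hm]
    exact mul_pos (inv_pos.2 hL) (intervalIntegral.intervalIntegral_pos_of_pos
      (hqc.intervalIntegrable _ _) hpos hL)
  obtain ⟨s₀, hs₀, hmax⟩ := (isCompact_Icc (a := (0 : ℝ)) (b := L)).exists_isMaxOn
    ⟨0, le_rfl, hL.le⟩ hqc.continuousOn
  set M := q s₀
  have hM : 0 < M := hpos s₀
  have hsplit : ∀ c, 0 < c → ∫ s in (0 : ℝ)..L, q s * Real.log (q s / c) =
      (∫ s in (0 : ℝ)..L, q s * Real.log (q s)) - L * m * Real.log c := by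
    intro c hc
    rw [← hint, ← intervalIntegral.integral_mul_const, ← intervalIntegral.integral_sub]
    · refine intervalIntegral.integral_congr fun s _ => ?_
      simp only [Real.log_div (hpos s).ne' hc.ne']
      ring
    · exact (hqc.mul hqlog).intervalIntegrable _ _
    · exact (hqc.mul continuous_const).intervalIntegrable _ _
  set r : ℝ → ℝ := fun s => √(q s)
  set r' : ℝ → ℝ := fun s => q' s / (2 * √(q s))
  have hr : ∀ s, HasDerivAt r (r' s) s := fun s => (hq s).sqrt (hpos s).ne'
  have hrpos : ∀ s, 0 < √(q s) := fun s => Real.sqrt_pos.2 (hpos s)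
  have hr' : Continuous r' :=
    hq'.div (continuous_const.mul hqc.sqrt) fun s => by have := hrpos s; positivity
  set B := ∫ s in (0 : ℝ)..L, |r' s|
  have hosc : ∀ s ∈ Icc 0 L, (√(q s) - √M) ^ 2 ≤ B ^ 2 := by
    intro s hs
    rw [sq_le_sq]
    refine le_trans ?_ (le_abs_self B)
    rcases le_total s s₀ with h | h
    · rw [abs_sub_comm]
      exact sub_le_integral_abs_deriv hr hr' hs.1 h hs₀.2
    · exact sub_le_integral_abs_deriv hr hr' hs₀.1 h hs.2
  have hB : B ^ 2 ≤ L * ((∫ s in (0 : ℝ)..L, q' s ^ 2 / q s) / 4) := by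
    refine (sq_integral_le hL hr'.abs).trans (le_of_eq ?_)
    rw [← intervalIntegral.integral_div]
    congr 1
    refine intervalIntegral.integral_congr fun s _ => ?_
    simp only [r', sq_abs, div_pow, mul_pow, Real.sq_sqrt (hpos s).le]
    ring
  have hle : ∫ s in (0 : ℝ)..L, (q s * Real.log (q s / M) - q s + M) ≤
      ∫ s in (0 : ℝ)..L, 4 * B ^ 2 := by
    refine intervalIntegral.integral_mono_on hL.le ?_ intervalIntegrable_const fun s hs => ?_
    · have : Continuous fun s => Real.log (q s / M) :=
        (hqc.div_const M).log fun s => (div_pos (hpos s) hM).ne'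
      exact Continuous.intervalIntegrable (by fun_prop) _ _
    · have h1 := entropyIntegrand_le_of_le (hpos s) (hmax hs)
      have h2 := hosc s hs
      simp only [M] at h1 h2 ⊢
      linarith
  have hsum : ∫ s in (0 : ℝ)..L, (q s * Real.log (q s / M) - q s + M) =
      (∫ s in (0 : ℝ)..L, q s * Real.log (q s)) - L * m * Real.log M - L * m + L * M := by
    have hc : Continuous fun s => Real.log (q s / M) :=
      (hqc.div_const M).log fun s => (div_pos (hpos s) hM).ne'
    rw [intervalIntegral.integral_add, intervalIntegral.integral_sub, hsplit M hM, hint,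
      intervalIntegral.integral_const]
    · simp
    all_goals exact Continuous.intervalIntegrable (by fun_prop) _ _
  -- Exactly the difference between the Bregman entropies taken relative to `M` and to `m`.
  have hgap := mul_nonneg hL.le (entropyIntegrand_nonneg hmpos hM)
  rw [Real.log_div hmpos.ne' hM.ne'] at hgap
  rw [hsplit m hmpos]
  rw [hsum, intervalIntegral.integral_const, sub_zero, smul_eq_mul] at hle
  have := mul_le_mul_of_nonneg_left hB hL.le
  nlinarith

/-! ### Tensorization -/

theorem coordAvg_mul_log_div_le (hL : 0 < L) {v : (Fin d → ℝ) → ℝ} (hv : ContDiff ℝ 1 v)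
    (hper : IsPeriodic L v) (hpos : ∀ x, 0 < v x) (k : Fin d) (x : Fin d → ℝ) :
    coordAvg L k (fun y => v y * Real.log (v y / coordAvg L k v y)) x ≤
      L ^ 2 * coordAvg L k (fun y => pderiv k v y ^ 2 / v y) x := by
  have h1 := integral_mul_log_div_mean_le hL
    (fun s => hasDerivAt_line (hv.differentiable one_ne_zero) k x s)
    (continuous_line (continuous_pderiv hv k) k x) (fun s => hpos _)
    (m := coordAvg L k v x) rfl
  unfold coordAvg at h1 ⊢
  rw [mul_left_comm]
  refine mul_le_mul_of_nonneg_left (le_trans (le_of_eq ?_) h1) (inv_pos.2 hL).le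
  refine intervalIntegral.integral_congr fun s _ => ?_
  have := coordAvg_add_single_self hper k x s
  unfold coordAvg at this
  simp only [this]

/-- Jensen for the jointly convex function `a² / b`: average the tangent plane bound `a² / b ≥ 2 c a
- c² b` at the slope `c` given by the ratio of the averages. -/
theorem sq_coordAvg_div_le (hL : 0 < L) {a b : (Fin d → ℝ) → ℝ} (ha : Continuous a)
    (hb : Continuous b) (hpos : ∀ x, 0 < b x) (k : Fin d) (x : Fin d → ℝ) :
    coordAvg L k a x ^ 2 / coordAvg L k b x ≤ coordAvg L k (fun y => a y ^ 2 / b y) x := by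
  have hB := coordAvg_pos hL hb hpos k x
  set c := coordAvg L k a x / coordAvg L k b x with hc
  have h1 := coordAvg_mono hL (g := fun y => 2 * c * a y - c ^ 2 * b y)
    (h := fun y => a y ^ 2 / b y) (by fun_prop)
    ((ha.pow 2).div hb fun y => (hpos y).ne') k x fun y => by
      rw [le_div_iff₀ (hpos y)]
      nlinarith [sq_nonneg (a y - c * b y)]
  refine le_trans (le_of_eq ?_) h1
  rw [coordAvg_sub (by fun_prop) (by fun_prop),
    coordAvg_mul_left (c := fun _ => 2 * c) k x (fun _ => rfl),
    coordAvg_mul_left (c := fun _ => c ^ 2) k x (fun _ => rfl), hc]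
  field_simp
  ring

/-- Tensorization, by induction on the set `S` of coordinates on which `v` may depend. With `w` the
average of `v` over coordinate `k`, the entropy of `v` is `∫ v log (v / w)` plus the entropy of `w`.
The first term is bounded on each line by the one-dimensional inequality, the second by induction,
since averaging does not increase the Fisher terms. -/
theorem entropy_le_sum_fisher (hL : 0 < L) (S : Finset (Fin d)) :
    ∀ v : (Fin d → ℝ) → ℝ, ContDiff ℝ 1 v → IsPeriodic L v → (∀ x, 0 < v x) →
      (∀ i ∉ S, ∀ x s, v (x + Pi.single i s) = v x) →
      torusIntegral L (fun x => v x * Real.log (v x)) -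
          torusIntegral L v * Real.log ((L ^ d)⁻¹ * torusIntegral L v) ≤
        L ^ 2 * ∑ j ∈ S, torusIntegral L (fun x => pderiv j v x ^ 2 / v x) := by
  have hLd : 0 < L ^ d := pow_pos hL d
  induction S using Finset.induction_on with
  | empty =>
    intro v hv hper hpos hinv
    have hconst : v = fun _ => v 0 := by
      funext x
      have := apply_add_eq_of_forall_single (G := v) x
        (fun i y => hinv i (Finset.notMem_empty i) y (x i)) 0
      simpa using this
    rw [hconst]
    simp only [torusIntegral_const hL]
    rw [inv_mul_cancel_left₀ hLd.ne']
    simp [mul_assoc]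
  | insert k S hk ih =>
    intro v hv hper hpos hinv
    set w := coordAvg L k v with hw
    have hvc := hv.continuous
    have hwC : ContDiff ℝ 1 w := contDiff_coordAvg hv k
    have hwc := hwC.continuous
    have hwper : IsPeriodic L w := hper.coordAvg k
    have hwpos : ∀ x, 0 < w x := coordAvg_pos hL hvc hpos k
    have hwk : ∀ x s, w (x + Pi.single k s) = w x := coordAvg_add_single_self hper k
    have hwinv : ∀ i ∉ S, ∀ x s, w (x + Pi.single i s) = w x := by
      intro i hi x s
      by_cases hik : i = k
      · rw [hik, hwk]
      · simp only [hw, coordAvg]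
        congr 2 with r
        rw [add_right_comm, hinv i (by simp [hik, hi])]
    have hlogv : Continuous fun x => Real.log (v x) := hvc.log fun x => (hpos x).ne'
    have hlogw : Continuous fun x => Real.log (w x) := hwc.log fun x => (hwpos x).ne'
    have hmass : torusIntegral L w = torusIntegral L v := torusIntegral_coordAvg hL hvc hper k
    -- `log w` is constant along `k`-lines, so `v` may be replaced by its average.
    have hvw : torusIntegral L (fun x => Real.log (w x) * v x) =
        torusIntegral L (fun x => w x * Real.log (w x)) := by
      rw [← torusIntegral_coordAvg hL (by fun_prop) ((hwper.comp Real.log).mul hper) k]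
      congr 1 with x
      rw [coordAvg_mul_left (c := fun x => Real.log (w x)) k x fun r => by rw [hwk], mul_comm]
    have hfisher : ∀ j, Continuous fun x => pderiv j v x ^ 2 / v x := fun j =>
      ((continuous_pderiv hv j).pow 2).div hvc fun x => (hpos x).ne'
    have hfisherper : ∀ j, IsPeriodic L fun x => pderiv j v x ^ 2 / v x := fun j i x => by
      simp only [hper.pderiv j i x, hper i x]
    have hdivper : IsPeriodic L fun x => v x * Real.log (v x / w x) := fun i x => by
      simp only [hper i x, hwper i x]
    have hdivc : Continuous fun x => v x * Real.log (v x / w x) :=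
      hvc.mul ((hvc.div hwc fun x => (hwpos x).ne').log fun x =>
        (div_pos (hpos x) (hwpos x)).ne')
    have hline : torusIntegral L (fun x => v x * Real.log (v x / w x)) ≤
        L ^ 2 * torusIntegral L (fun x => pderiv k v x ^ 2 / v x) := by
      rw [← torusIntegral_coordAvg hL hdivc hdivper k,
        ← torusIntegral_coordAvg hL (hfisher k) (hfisherper k) k, ← torusIntegral_const_mul]
      exact torusIntegral_mono (continuous_coordAvg hdivc k)
        (continuous_const.mul (continuous_coordAvg (hfisher k) k))
        (coordAvg_mul_log_div_le hL hv hper hpos k)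
    have hdiv : torusIntegral L (fun x => v x * Real.log (v x / w x)) =
        torusIntegral L (fun x => v x * Real.log (v x)) -
          torusIntegral L (fun x => Real.log (w x) * v x) := by
      rw [← torusIntegral_sub (by fun_prop) (by fun_prop)]
      congr 1 with x
      rw [Real.log_div (hpos x).ne' (hwpos x).ne']
      ring
    have hjensen : ∀ j, torusIntegral L (fun x => pderiv j w x ^ 2 / w x) ≤
        torusIntegral L (fun x => pderiv j v x ^ 2 / v x) := by
      intro j
      rw [← torusIntegral_coordAvg hL (hfisher j) (hfisherper j) k]
      refine torusIntegral_mono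
        (((continuous_pderiv hwC j).pow 2).div hwc fun x => (hwpos x).ne')
        (continuous_coordAvg (hfisher j) k) fun x => ?_
      rw [hw, pderiv_coordAvg hv]
      exact sq_coordAvg_div_le hL (continuous_pderiv hv j) hvc hpos k x
    have hih := ih w hwC hwper hwpos hwinv
    have hsum := mul_le_mul_of_nonneg_left (Finset.sum_le_sum fun j (_ : j ∈ S) => hjensen j)
      (sq_nonneg L)
    rw [hmass] at hih
    rw [Finset.sum_insert hk, mul_add]
    linarith

theorem mul_gradSq_log {v : (Fin d → ℝ) → ℝ} (hv : Differentiable ℝ v) (hpos : ∀ x, 0 < v x)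
    (x : Fin d → ℝ) : v x * gradSq (fun y => Real.log (v y)) x = gradSq v x / v x := by
  have hx := hpos x
  unfold gradSq
  rw [Finset.mul_sum, Finset.sum_div]
  refine Finset.sum_congr rfl fun j _ => ?_
  rw [pderiv_comp (Real.hasDerivAt_log hx.ne') hv]
  field_simp

theorem logSobolevInequality (hL : 0 < L) : LogSobolevInequality d L (2 * L ^ 2) := by
  intro v hv hper hpos hmass
  have hLd : 0 < L ^ d := pow_pos hL d
  have hvc := hv.continuous
  have h1 := entropy_le_sum_fisher hL Finset.univ v hv hper hpos (by simp)
  have hfisher : ∀ j, Continuous fun x => pderiv j v x ^ 2 / v x := fun j =>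
    ((continuous_pderiv hv j).pow 2).div hvc fun x => (hpos x).ne'
  have hlog : Continuous fun x => Real.log (v x) := hvc.log fun x => (hpos x).ne'
  rw [hmass, mul_one, one_mul, Real.log_inv, ← torusIntegral_sum _ hfisher] at h1
  have h2 : torusIntegral L (fun x => v x * Real.log (L ^ d * v x)) =
      torusIntegral L (fun x => v x * Real.log (v x)) + Real.log (L ^ d) := by
    have : torusIntegral L (fun x => v x * Real.log (L ^ d)) = Real.log (L ^ d) := by
      rw [torusIntegral_mul_const, hmass, one_mul]
    rw [← this, ← torusIntegral_add (by fun_prop) (by fun_prop)]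
    congr 1 with x
    rw [Real.log_mul hLd.ne' (hpos x).ne']
    ring
  rw [h2]
  simp only [mul_gradSq_log (hv.differentiable one_ne_zero) hpos]
  simp only [gradSq, Finset.sum_div]
  linarith

/-! ### The Poincaré and log-Sobolev constants -/

theorem continuous_gradSq (hg : ContDiff ℝ 1 g) : Continuous (gradSq g) :=
  continuous_finsetSum _ fun i _ => (continuous_pderiv hg i).pow 2

theorem gradSq_nonneg (g : (Fin d → ℝ) → ℝ) (x : Fin d → ℝ) : 0 ≤ gradSq g x :=
  Finset.sum_nonneg fun _ _ => sq_nonneg _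

theorem gradSq_comp {φ : ℝ → ℝ} {φ' : ℝ} {x : Fin d → ℝ} (hφ : HasDerivAt φ φ' (g x))
    (hg : Differentiable ℝ g) : gradSq (fun y => φ (g y)) x = φ' ^ 2 * gradSq g x := by
  unfold gradSq
  rw [Finset.mul_sum]
  exact Finset.sum_congr rfl fun i _ => by rw [pderiv_comp hφ hg, mul_pow]

theorem LogSobolevInequality.mono {C C' : ℝ} (hC : LogSobolevInequality d L C) (hCC' : C ≤ C') :
    LogSobolevInequality d L C' := by
  intro v hv hper hpos hmass
  refine (hC v hv hper hpos hmass).trans ?_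
  gcongr
  exact torusIntegral_nonneg fun x => mul_nonneg (hpos x).le (gradSq_nonneg _ x)

/-- Test with the density `(1 + δ u) / L ^ d`, where `δ` is small but fixed. The entropy is at least
a ninth of the quadratic term and the Fisher information at most twice its quadratic counterpart, so
`C / 2` becomes `9 C` and no limit is needed. -/
theorem LogSobolevInequality.poincareInequality (hL : 0 < L) {C : ℝ} (hC0 : 0 ≤ C)
    (hC : LogSobolevInequality d L C) : PoincareInequality d L (9 * C) := by
  intro u hu hper hmean
  have hLd : 0 < L ^ d := pow_pos hL d
  have huc := hu.continuous
  have hud := hu.differentiable one_ne_zero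
  obtain ⟨K, hK⟩ := hper.exists_abs_le hL huc
  have hK0 : 0 ≤ K := (abs_nonneg _).trans (hK 0)
  obtain ⟨δ, hδ, hδK⟩ : ∃ δ : ℝ, 0 < δ ∧ δ * K ≤ 1 / 2 := by
    -- `K + 1` rather than `K` because the bound `K` may be zero.
    refine ⟨1 / (2 * (K + 1)), by positivity, ?_⟩
    rw [div_mul_eq_mul_div, div_le_div_iff₀ (by positivity) (by norm_num)]
    linarith
  have hs : ∀ x, |δ * u x| ≤ 1 / 2 := fun x => by
    rw [abs_mul, abs_of_pos hδ]
    exact (mul_le_mul_of_nonneg_left (hK x) hδ.le).trans hδK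
  have hlow : ∀ x, 1 / 2 ≤ 1 + δ * u x := fun x => by linarith [(abs_le.1 (hs x)).1]
  have hup : ∀ x, 1 + δ * u x ≤ 4 := fun x => by linarith [(abs_le.1 (hs x)).2]
  have hpos1 : ∀ x, 0 < 1 + δ * u x := fun x => by linarith [hlow x]
  have hpos : ∀ x, 0 < (L ^ d)⁻¹ * (1 + δ * u x) := fun x =>
    mul_pos (inv_pos.2 hLd) (hpos1 x)
  have hmass1 : torusIntegral L (fun x => 1 + δ * u x) = L ^ d := by
    rw [torusIntegral_add (by fun_prop) (by fun_prop), torusIntegral_const hL,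
      torusIntegral_const_mul, hmean]
    ring
  have hmass : torusIntegral L (fun x => (L ^ d)⁻¹ * (1 + δ * u x)) = 1 := by
    rw [torusIntegral_const_mul, hmass1, inv_mul_cancel₀ hLd.ne']
  have hv : ContDiff ℝ 1 fun x => (L ^ d)⁻¹ * (1 + δ * u x) := by fun_prop
  have hlsi := hC _ hv (hper.comp fun r => (L ^ d)⁻¹ * (1 + δ * r)) hpos hmass
  have hlogc : Continuous fun x => Real.log (1 + δ * u x) :=
    Continuous.log (by fun_prop) fun x => (hpos1 x).ne'
  have hleft : (L ^ d)⁻¹ * (δ ^ 2 / 9 * torusIntegral L (fun x => u x ^ 2)) ≤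
      torusIntegral L (fun x => (L ^ d)⁻¹ * (1 + δ * u x) *
        Real.log (L ^ d * ((L ^ d)⁻¹ * (1 + δ * u x)))) := by
    simp only [mul_inv_cancel_left₀ hLd.ne', mul_assoc]
    rw [torusIntegral_const_mul]
    refine mul_le_mul_of_nonneg_left ?_ (inv_pos.2 hLd).le
    have h1 : torusIntegral L (fun x => (1 + δ * u x) * Real.log (1 + δ * u x)) =
        torusIntegral L (fun x => (1 + δ * u x) * Real.log (1 + δ * u x) - (1 + δ * u x) + 1) := by
      rw [torusIntegral_add (by fun_prop) (by fun_prop),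
        torusIntegral_sub (by fun_prop) (by fun_prop), torusIntegral_const hL, hmass1]
      ring
    rw [h1, ← torusIntegral_const_mul]
    refine torusIntegral_mono (by fun_prop) (by fun_prop) fun x => ?_
    refine le_trans (le_of_eq ?_) (sq_sub_one_le_entropyIntegrand (hpos1 x) (hup x))
    ring
  have hright : torusIntegral L (fun x => (L ^ d)⁻¹ * (1 + δ * u x) *
        gradSq (fun y => Real.log ((L ^ d)⁻¹ * (1 + δ * u y))) x) ≤
      (L ^ d)⁻¹ * (2 * δ ^ 2 * torusIntegral L (gradSq u)) := by
    have hgrad : ∀ x, gradSq (fun y => (L ^ d)⁻¹ * (1 + δ * u y)) x =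
        ((L ^ d)⁻¹ * δ) ^ 2 * gradSq u x := fun x => by
      refine gradSq_comp (φ := fun r => (L ^ d)⁻¹ * (1 + δ * r)) ?_ hud
      have h0 := ((((hasDerivAt_id (u x)).const_mul δ).const_add 1).const_mul (L ^ d)⁻¹)
      simpa using h0
    have hgc := continuous_gradSq hu
    simp only [mul_gradSq_log (hv.differentiable one_ne_zero) hpos, hgrad]
    rw [← torusIntegral_const_mul, ← torusIntegral_const_mul]
    refine torusIntegral_mono ((continuous_const.mul hgc).div hv.continuous
      fun x => (hpos x).ne') (by fun_prop) fun x => ?_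
    rw [div_le_iff₀ (hpos x)]
    have h2 : 1 ≤ 2 * (1 + δ * u x) := by linarith [hlow x]
    have h3 : 0 ≤ ((L ^ d)⁻¹ * δ) ^ 2 * gradSq u x :=
      mul_nonneg (sq_nonneg _) (gradSq_nonneg u x)
    nlinarith [mul_le_mul_of_nonneg_left h2 h3]
  have h4 := hleft.trans (hlsi.trans (mul_le_mul_of_nonneg_left hright (by positivity : (0 : ℝ) ≤ C / 2)))
  have h5 : C / 2 * ((L ^ d)⁻¹ * (2 * δ ^ 2 * torusIntegral L (gradSq u))) =
      (L ^ d)⁻¹ * (δ ^ 2 / 9 * (9 * C * torusIntegral L (gradSq u))) := by ring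
  rw [h5] at h4
  exact le_of_mul_le_mul_left (le_of_mul_le_mul_left h4 (inv_pos.2 hLd)) (by positivity)

/-! ### Positivity and attainment of the best constants. -/

theorem exists_pos_le_of_poincareInequality (hd : 1 ≤ d) (hL : 0 < L) :
    ∃ c, 0 < c ∧ ∀ C, PoincareInequality d L C → c ≤ C := by
  set k : Fin d := ⟨0, hd⟩
  set ω := 2 * Real.pi / L with hω
  have hωpos : 0 < ω := by have := Real.pi_pos; positivity
  have hωL : ω * L = 2 * Real.pi := by rw [hω]; field_simp
  have hcoord : ∀ (i : Fin d) (x : Fin d → ℝ),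
      ω * (x + Pi.single i L : Fin d → ℝ) k = ω * x k ∨
      ω * (x + Pi.single i L : Fin d → ℝ) k = ω * x k + 2 * Real.pi := by
    intro i x
    by_cases h : k = i
    · right
      rw [← h, ← hωL]
      simp [mul_add]
    · left
      simp [h]
  set v : (Fin d → ℝ) → ℝ := fun x => Real.sin (ω * x k)
  have hproj : ContDiff ℝ 1 fun x : Fin d → ℝ => ω * x k := by fun_prop
  have hv : ContDiff ℝ 1 v := Real.contDiff_sin.comp hproj
  have hper : IsPeriodic L v := fun i x => by
    rcases hcoord i x with h | h <;> simp only [v, h, Real.sin_add_two_pi]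
  have hcos : ContDiff ℝ 1 fun x : Fin d → ℝ => Real.cos (ω * x k) :=
    Real.contDiff_cos.comp hproj
  have hcosper : IsPeriodic L fun x : Fin d → ℝ => Real.cos (ω * x k) := fun i x => by
    rcases hcoord i x with h | h <;> simp only [h, Real.cos_add_two_pi]
  have hpd : ∀ x, pderiv k (fun x : Fin d → ℝ => Real.cos (ω * x k)) x = -ω * v x := by
    intro x
    have h1 : HasFDerivAt (fun x : Fin d → ℝ => x k)
        (ContinuousLinearMap.proj (R := ℝ) (φ := fun _ : Fin d => ℝ) k) x :=
      hasFDerivAt_apply k x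
    have h2 := (h1.const_mul ω).cos
    unfold pderiv
    rw [h2.fderiv]
    simp [v, mul_comm]
  have hmean : torusIntegral L v = 0 := by
    have h0 := torusIntegral_pderiv hL hcos hcosper k
    rw [funext hpd, torusIntegral_const_mul] at h0
    exact (mul_eq_zero.1 h0).resolve_left (neg_ne_zero.2 hωpos.ne')
  set A := torusIntegral L (fun x => v x ^ 2)
  set B := torusIntegral L (gradSq v)
  have hB : 0 ≤ B := torusIntegral_nonneg (gradSq_nonneg v)
  have hA : 0 < A := by
    refine lt_of_le_of_ne (torusIntegral_nonneg fun x => sq_nonneg _) fun h => ?_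
    have h1 := eq_zero_on_cell_of_torusIntegral_eq_zero hL (hv.continuous.pow 2)
      (fun x => sq_nonneg _) h.symm (fun _ => L / 4)
      ⟨fun _ => by simp only [Pi.zero_apply]; linarith, fun _ => by simp only; linarith⟩
    have h2 : ω * (L / 4) = Real.pi / 2 := by linarith
    simp [v, h2] at h1
  -- The `+ 1` avoids having to show `B > 0`; it is harmless because `A ≤ C B` and `A > 0` force `C
  -- > 0`.
  refine ⟨A / (B + 1), by positivity, fun C hC => ?_⟩
  have h1 : A ≤ C * B := hC v hv hper hmean
  have h2 : 0 < C := by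
    by_contra! hneg
    nlinarith [mul_nonneg (neg_nonneg.2 hneg) hB]
  rw [div_le_iff₀ (by positivity)]
  linarith

theorem exists_pos_le_of_logSobolevInequality (hd : 1 ≤ d) (hL : 0 < L) :
    ∃ c, 0 < c ∧ ∀ C, LogSobolevInequality d L C → c ≤ C := by
  obtain ⟨c, hc, hle⟩ := exists_pos_le_of_poincareInequality hd hL
  refine ⟨c / 9, by positivity, fun C hC => ?_⟩
  -- Passing to a Poincaré inequality requires a nonnegative constant; the resulting bound then
  -- excludes `max C 0 = 0`.
  have h1 := hle _ ((hC.mono (le_max_left C 0)).poincareInequality hL (le_max_right C 0))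
  rcases max_cases C 0 with h | h
  · rw [h.1] at h1
    linarith
  · rw [h.1] at h1
    linarith

/-- Lets the infimum of the admissible constants be used as an admissible constant. -/
theorem le_csInf_mul {S : Set ℝ} (hS : S.Nonempty) {A B : ℝ} (hB : 0 ≤ B)
    (h : ∀ C ∈ S, A ≤ C * B) : A ≤ sInf S * B := by
  rcases hB.eq_or_lt with rfl | hB
  · obtain ⟨C, hC⟩ := hS
    simpa using h C hC
  · rw [← div_le_iff₀ hB]
    exact le_csInf hS fun C hC => (div_le_iff₀ hB).2 (h C hC)

theorem nonempty_poincare (d : ℕ) (hL : 0 < L) : {C | PoincareInequality d L C}.Nonempty :=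
  ⟨_, (logSobolevInequality hL).poincareInequality hL (by positivity)⟩

theorem nonempty_logSobolev (d : ℕ) (hL : 0 < L) : {C | LogSobolevInequality d L C}.Nonempty :=
  ⟨_, logSobolevInequality hL⟩

theorem poincareConst_pos (hd : 1 ≤ d) (hL : 0 < L) : 0 < poincareConst d L := by
  obtain ⟨c, hc, hle⟩ := exists_pos_le_of_poincareInequality hd hL
  exact hc.trans_le (le_csInf (nonempty_poincare d hL) hle)

theorem logSobolevConst_pos (hd : 1 ≤ d) (hL : 0 < L) : 0 < logSobolevConst d L := by
  obtain ⟨c, hc, hle⟩ := exists_pos_le_of_logSobolevInequality hd hL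
  exact hc.trans_le (le_csInf (nonempty_logSobolev d hL) hle)

theorem poincareInequality_poincareConst (hL : 0 < L) :
    PoincareInequality d L (poincareConst d L) := fun v hv hper hmean =>
  le_csInf_mul (nonempty_poincare d hL) (torusIntegral_nonneg (gradSq_nonneg v))
    fun _ hC => hC v hv hper hmean

theorem logSobolevInequality_logSobolevConst (hL : 0 < L) :
    LogSobolevInequality d L (logSobolevConst d L) := by
  intro v hv hper hpos hmass
  have hI : 0 ≤ torusIntegral L (fun x => v x * gradSq (fun y => Real.log (v y)) x) :=
    torusIntegral_nonneg fun x => mul_nonneg (hpos x).le (gradSq_nonneg _ x)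
  rw [div_mul_eq_mul_div, mul_div_assoc]
  refine le_csInf_mul (nonempty_logSobolev d hL) (by positivity) fun C hC => ?_
  rw [← mul_div_assoc, ← div_mul_eq_mul_div]
  exact hC v hv hper hpos hmass

/-! ### Perturbed Poincaré and log-Sobolev inequalities -/

/-- The `w`-mean minimizes the `w`-weighted square deviation, so `u` may be recentred at its
Lebesgue mean; only then is `w` replaced by `W`. -/
theorem weighted_poincare (hL : 0 < L) {w u : (Fin d → ℝ) → ℝ} {W C : ℝ} (hw : Continuous w)
    (hw0 : ∀ x, 0 ≤ w x) (hwW : ∀ x, w x ≤ W) (hC : PoincareInequality d L C)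
    (hu : ContDiff ℝ 1 u) (hper : IsPeriodic L u)
    (hmean : torusIntegral L (fun x => w x * u x) = 0) :
    torusIntegral L (fun x => w x * u x ^ 2) ≤ W * (C * torusIntegral L (gradSq u)) := by
  have hLd : 0 < L ^ d := pow_pos hL d
  have huc := hu.continuous
  have hW : 0 ≤ W := (hw0 0).trans (hwW 0)
  set c := (L ^ d)⁻¹ * torusIntegral L u with hc
  have hcent : torusIntegral L (fun x => u x - c) = 0 := by
    rw [torusIntegral_sub huc continuous_const, torusIntegral_const hL, hc,
      mul_inv_cancel_left₀ hLd.ne', sub_self]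
  have hgrad : gradSq (fun x => u x - c) = gradSq u := by
    funext x
    have := gradSq_comp (φ := fun r => r - c) ((hasDerivAt_id (u x)).sub_const c)
      (hu.differentiable one_ne_zero)
    simpa using this
  have hpi := hC (fun x => u x - c) (by fun_prop) (hper.comp fun r => r - c) hcent
  rw [hgrad] at hpi
  refine le_trans ?_ (mul_le_mul_of_nonneg_left hpi hW)
  have h1 : torusIntegral L (fun x => w x * (u x - c) ^ 2) =
      torusIntegral L (fun x => w x * u x ^ 2) + c ^ 2 * torusIntegral L w := by
    have : ∀ x, w x * (u x - c) ^ 2 = w x * u x ^ 2 - 2 * c * (w x * u x) + c ^ 2 * w x :=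
      fun x => by ring
    simp only [this]
    rw [torusIntegral_add (by fun_prop) (by fun_prop),
      torusIntegral_sub (by fun_prop) (by fun_prop), torusIntegral_const_mul,
      torusIntegral_const_mul, hmean]
    ring
  have h2 : torusIntegral L (fun x => w x * (u x - c) ^ 2) ≤
      W * torusIntegral L (fun x => (u x - c) ^ 2) := by
    rw [← torusIntegral_const_mul]
    exact torusIntegral_mono (by fun_prop) (by fun_prop) fun x =>
      mul_le_mul_of_nonneg_right (hwW x) (sq_nonneg _)
  have h3 : 0 ≤ c ^ 2 * torusIntegral L w := mul_nonneg (sq_nonneg c) (torusIntegral_nonneg hw0)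
  linarith

theorem torusIntegral_pos (hL : 0 < L) (hg : Continuous g) (hpos : ∀ x, 0 < g x) :
    0 < torusIntegral L g := by
  refine lt_of_le_of_ne (torusIntegral_nonneg fun x => (hpos x).le) fun h => ?_
  exact (hpos 0).ne' (eq_zero_on_cell_of_torusIntegral_eq_zero hL hg (fun x => (hpos x).le)
    h.symm 0 ⟨le_rfl, fun _ => hL.le⟩)

/-- Both sides are homogeneous of degree one when `M` scales with `g`, so the unit mass
normalization is immaterial. -/
theorem entropy_le_of_logSobolev (hL : 0 < L) {C M : ℝ} (hC : LogSobolevInequality d L C)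
    (hg : ContDiff ℝ 1 g) (hper : IsPeriodic L g) (hpos : ∀ x, 0 < g x)
    (hM : torusIntegral L g = L ^ d * M) :
    torusIntegral L (fun x => g x * Real.log (g x / M)) ≤
      C / 2 * torusIntegral L (fun x => gradSq g x / g x) := by
  have hLd : 0 < L ^ d := pow_pos hL d
  have hgd := hg.differentiable one_ne_zero
  have hMpos : 0 < M := by
    have := torusIntegral_pos hL hg.continuous hpos
    rw [hM] at this
    exact (mul_pos_iff_of_pos_left hLd).1 this
  set c := (L ^ d * M)⁻¹ with hc
  have hcpos : 0 < c := inv_pos.2 (mul_pos hLd hMpos)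
  have hvpos : ∀ x, 0 < c * g x := fun x => mul_pos hcpos (hpos x)
  have hv : ContDiff ℝ 1 fun x => c * g x := by fun_prop
  have hlsi := hC (fun x => c * g x) hv (hper.comp fun r => c * r) hvpos
    (by rw [torusIntegral_const_mul, hM, hc, inv_mul_cancel₀ (mul_pos hLd hMpos).ne'])
  simp only [mul_gradSq_log (hv.differentiable one_ne_zero) hvpos] at hlsi
  have h1 : ∀ x, c * g x * Real.log (L ^ d * (c * g x)) = c * (g x * Real.log (g x / M)) := by
    intro x
    have : L ^ d * (c * g x) = g x / M := by rw [hc]; field_simp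
    rw [this, mul_assoc]
  have h2 : ∀ x, gradSq (fun y => c * g y) x / (c * g x) = c * (gradSq g x / g x) := by
    intro x
    have hx := hpos x
    have h0 : HasDerivAt (fun r => c * r) c (g x) := by
      simpa using (hasDerivAt_id (g x)).const_mul c
    rw [gradSq_comp h0 hgd]
    field_simp
  simp only [h1, h2, torusIntegral_const_mul] at hlsi
  rw [mul_left_comm] at hlsi
  exact le_of_mul_le_mul_left hlsi hcpos

/-- As in `weighted_poincare`, with the Bregman form of the entropy in place of the square: the
`w`-mean `m` is its optimal reference, and the integrand relative to the Lebesgue mean `M` is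
nonnegative, so `w ≤ W` applies pointwise. -/
theorem weighted_logSobolev (hL : 0 < L) {w : (Fin d → ℝ) → ℝ} {W C m : ℝ} (hw : Continuous w)
    (hw0 : ∀ x, 0 ≤ w x) (hwW : ∀ x, w x ≤ W) (hC : LogSobolevInequality d L C)
    (hg : ContDiff ℝ 1 g) (hper : IsPeriodic L g) (hpos : ∀ x, 0 < g x) (hm : 0 < m)
    (hmean : torusIntegral L (fun x => w x * g x) = m * torusIntegral L w) :
    torusIntegral L (fun x => w x * (g x * Real.log (g x / m))) ≤
      W * (C / 2 * torusIntegral L (fun x => gradSq g x / g x)) := by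
  have hLd : 0 < L ^ d := pow_pos hL d
  have hgc := hg.continuous
  have hlogc : Continuous fun x => Real.log (g x) := hgc.log fun x => (hpos x).ne'
  have hW : 0 ≤ W := (hw0 0).trans (hwW 0)
  set M := (L ^ d)⁻¹ * torusIntegral L g with hMdef
  have hMpos : 0 < M := mul_pos (inv_pos.2 hLd) (torusIntegral_pos hL hgc hpos)
  have hM : torusIntegral L g = L ^ d * M := by rw [hMdef, mul_inv_cancel_left₀ hLd.ne']
  refine le_trans ?_ (mul_le_mul_of_nonneg_left
    (entropy_le_of_logSobolev hL hC hg hper hpos hM) hW)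
  have hlogM : Continuous fun x => Real.log (g x / M) :=
    (hgc.div_const M).log fun x => (div_pos (hpos x) hMpos).ne'
  have hsplit : ∀ c, 0 < c → torusIntegral L (fun x => w x * (g x * Real.log (g x / c))) =
      torusIntegral L (fun x => w x * (g x * Real.log (g x))) -
        Real.log c * (m * torusIntegral L w) := by
    intro c hc
    rw [← hmean, ← torusIntegral_const_mul, ← torusIntegral_sub (by fun_prop) (by fun_prop)]
    congr 1 with x
    rw [Real.log_div (hpos x).ne' hc.ne']
    ring
  have h1 : torusIntegral L (fun x => w x * (g x * Real.log (g x / M) - g x + M)) =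
      torusIntegral L (fun x => w x * (g x * Real.log (g x / M))) -
        m * torusIntegral L w + M * torusIntegral L w := by
    rw [← hmean, ← torusIntegral_const_mul, ← torusIntegral_sub (by fun_prop) (by fun_prop),
      ← torusIntegral_add (by fun_prop) (by fun_prop)]
    congr 1 with x
    ring
  have h2 : torusIntegral L (fun x => w x * (g x * Real.log (g x / M) - g x + M)) ≤
      W * torusIntegral L (fun x => g x * Real.log (g x / M) - g x + M) := by
    rw [← torusIntegral_const_mul]
    exact torusIntegral_mono (by fun_prop) (by fun_prop) fun x =>
      mul_le_mul_of_nonneg_right (hwW x) (entropyIntegrand_nonneg (hpos x) hMpos)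
  have h3 : torusIntegral L (fun x => g x * Real.log (g x / M) - g x + M) =
      torusIntegral L (fun x => g x * Real.log (g x / M)) := by
    rw [torusIntegral_add (by fun_prop) (by fun_prop),
      torusIntegral_sub (by fun_prop) (by fun_prop), torusIntegral_const hL, hM]
    ring
  have h4 := mul_nonneg (torusIntegral_nonneg (L := L) hw0) (entropyIntegrand_nonneg hm hMpos)
  rw [Real.log_div hm.ne' hMpos.ne'] at h4
  rw [h3, h1, hsplit M hMpos] at h2
  rw [hsplit m hm]
  linarith

/-! ### Integrals depending on time -/

theorem continuousOn_torusIntegral {Φ : ℝ → (Fin d → ℝ) → ℝ}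
    (hΦ : ContinuousOn (fun p : ℝ × (Fin d → ℝ) => Φ p.1 p.2) (Ici 0 ×ˢ univ)) :
    ContinuousOn (fun t => torusIntegral L (Φ t)) (Ici 0) := by
  -- Freezing the function at its value at time 0 for negative times makes it globally continuous.
  have hc : Continuous (Function.uncurry fun (t : ℝ) (x : Fin d → ℝ) => Φ (max t 0) x) :=
    hΦ.comp_continuous (f := fun p : ℝ × (Fin d → ℝ) => (max p.1 0, p.2)) (by fun_prop)
      fun p => ⟨mem_Ici.2 (le_max_right _ _), trivial⟩
  have := continuous_parametric_integral_of_continuous (μ := volume) hc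
    (isCompact_Icc (a := (0 : Fin d → ℝ)) (b := fun _ => L))
  refine this.continuousOn.congr fun t ht => ?_
  simp only [torusIntegral, max_eq_left (mem_Ici.1 ht)]

theorem hasDerivAt_torusIntegral {Φ Φ' : ℝ → (Fin d → ℝ) → ℝ}
    (hΦ : ∀ t, 0 < t → Continuous (Φ t))
    (hderiv : ∀ t, 0 < t → ∀ x, HasDerivAt (fun s => Φ s x) (Φ' t x) t)
    (hΦ' : ContinuousOn (fun p : ℝ × (Fin d → ℝ) => Φ' p.1 p.2) (Ioi 0 ×ˢ univ))
    {t : ℝ} (ht : 0 < t) :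
    HasDerivAt (fun s => torusIntegral L (Φ s)) (torusIntegral L (Φ' t)) t := by
  have hsub : Icc (t / 2) (t + 1) ×ˢ Icc (0 : Fin d → ℝ) (fun _ => L) ⊆ Ioi 0 ×ˢ univ :=
    fun p hp => ⟨lt_of_lt_of_le (by positivity) hp.1.1, trivial⟩
  obtain ⟨K, hK⟩ := (isCompact_Icc.prod isCompact_Icc).bddAbove_image (hΦ'.mono hsub).norm
  refine (hasDerivAt_integral_of_dominated_loc_of_deriv_le (bound := fun _ => K)
    (Icc_mem_nhds (by linarith : t / 2 < t) (by linarith : t < t + 1)) ?_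
    (integrableOn_cell (hΦ t ht)) ?_ ?_ ?_ ?_).2
  · filter_upwards [lt_mem_nhds ht] with s hs using (hΦ s hs).aestronglyMeasurable
  · have : Continuous (Φ' t) :=
      hΦ'.comp_continuous (f := fun x => (t, x)) (by fun_prop) fun x => ⟨ht, trivial⟩
    exact this.aestronglyMeasurable
  · refine (ae_restrict_iff' measurableSet_Icc).2 (Eventually.of_forall fun x hx s hs => ?_)
    exact hK ⟨(s, x), ⟨hs, hx⟩, rfl⟩
  · exact integrableOn_const isCompact_Icc.measure_ne_top
  · refine Eventually.of_forall fun x s hs => hderiv s (lt_of_lt_of_le (by positivity) hs.1) x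

/-- Grönwall with differentiability only at positive times: `exp (κ s) E s` is nonincreasing, and
continuity reaches `s = 0`. -/
theorem le_exp_mul_of_deriv_le {E E' : ℝ → ℝ} {κ : ℝ} (hE : ContinuousOn E (Ici 0))
    (hderiv : ∀ t, 0 < t → HasDerivAt E (E' t) t) (hle : ∀ t, 0 < t → E' t ≤ -κ * E t)
    {t : ℝ} (ht : 0 ≤ t) : E t ≤ Real.exp (-κ * t) * E 0 := by
  have hd : ∀ s, 0 < s → HasDerivAt (fun s => Real.exp (κ * s) * E s)
      (Real.exp (κ * s) * κ * E s + Real.exp (κ * s) * E' s) s := by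
    intro s hs
    have h1 : HasDerivAt (fun s => κ * s) κ s := by simpa using (hasDerivAt_id s).const_mul κ
    exact h1.exp.mul (hderiv s hs)
  have hanti : AntitoneOn (fun s => Real.exp (κ * s) * E s) (Ici 0) := by
    refine antitoneOn_of_deriv_nonpos (convex_Ici 0)
      (ContinuousOn.mul (by fun_prop) hE) ?_ ?_
    · rw [interior_Ici]
      exact fun s hs => (hd s hs).differentiableAt.differentiableWithinAt
    · rw [interior_Ici]
      intro s hs
      rw [(hd s hs).deriv]
      have := mul_le_mul_of_nonneg_left (hle s hs) (Real.exp_pos (κ * s)).le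
      linarith
  have h2 := hanti (mem_Ici.2 le_rfl) (mem_Ici.2 ht) ht
  simp only [mul_zero, Real.exp_zero, one_mul] at h2
  have h3 := mul_le_mul_of_nonneg_left h2 (Real.exp_pos (-κ * t)).le
  rwa [← mul_assoc, ← Real.exp_add, neg_mul, neg_add_cancel, Real.exp_zero, one_mul,
    ← neg_mul] at h3

/-! ### The density relative to the Gibbs weight -/

/-- The unnormalized Gibbs weight `exp (-F / ε)`. -/
def gibbsWeight (ε : ℝ) (F : (Fin d → ℝ) → ℝ) (x : Fin d → ℝ) : ℝ := Real.exp (-(F x / ε))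

/-- The density of `p` relative to the Gibbs weight. -/
def relDensity (ε : ℝ) (F p : (Fin d → ℝ) → ℝ) (x : Fin d → ℝ) : ℝ := p x * Real.exp (F x / ε)

section Weight

variable {ε : ℝ} {f F p : (Fin d → ℝ) → ℝ}

theorem gibbsWeight_pos (x : Fin d → ℝ) : 0 < gibbsWeight ε F x := Real.exp_pos _

theorem continuous_gibbsWeight (hF : Continuous F) : Continuous (gibbsWeight ε F) := by
  unfold gibbsWeight
  fun_prop

theorem IsPeriodic.gibbsWeight (hF : IsPeriodic L F) : IsPeriodic L (gibbsWeight ε F) :=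
  hF.comp fun r => Real.exp (-(r / ε))

theorem gibbsWeight_mul_relDensity (x : Fin d → ℝ) :
    gibbsWeight ε F x * relDensity ε F p x = p x := by
  unfold gibbsWeight relDensity
  rw [mul_left_comm, ← Real.exp_add]
  simp

theorem contDiff_relDensity (hF : ContDiff ℝ 1 F) (hp : ContDiff ℝ 1 p) :
    ContDiff ℝ 1 (relDensity ε F p) := by
  unfold relDensity
  fun_prop

theorem IsPeriodic.relDensity (hF : IsPeriodic L F) (hp : IsPeriodic L p) :
    IsPeriodic L (relDensity ε F p) :=
  hp.mul (hF.comp fun r => Real.exp (r / ε))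

/-- The weight absorbs the drift, leaving a pure gradient; this makes the dissipation a weighted
Dirichlet form. -/
theorem flux_eq (hε : ε ≠ 0) (hF : Differentiable ℝ F) (hp : Differentiable ℝ p) (i : Fin d)
    (x : Fin d → ℝ) :
    flux ε f F p i x = ε * f x * gibbsWeight ε F x * pderiv i (relDensity ε F p) x := by
  have hexp : HasDerivAt (fun r => Real.exp (r / ε)) (Real.exp (F x / ε) * (1 / ε)) (F x) :=
    ((hasDerivAt_id (F x)).div_const ε).exp
  have h1 : pderiv i (relDensity ε F p) x = pderiv i p x * Real.exp (F x / ε) +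
      p x * (Real.exp (F x / ε) * (1 / ε) * pderiv i F x) := by
    unfold relDensity
    rw [pderiv_mul hp (by fun_prop), pderiv_comp hexp hF]
  have h2 : gibbsWeight ε F x * Real.exp (F x / ε) = 1 := by
    rw [gibbsWeight, ← Real.exp_add]
    simp
  have h3 : gibbsWeight ε F x * pderiv i (relDensity ε F p) x =
      pderiv i p x + p x * pderiv i F x / ε := by
    rw [h1]
    linear_combination (pderiv i p x + p x * pderiv i F x / ε) * h2
  rw [mul_assoc, h3, flux]
  field_simp
  ring

theorem IsPeriodic.flux (hf : IsPeriodic L f) (hF : IsPeriodic L F) (hp : IsPeriodic L p)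
    (i : Fin d) : IsPeriodic L (flux ε f F p i) := fun j x => by
  simp only [FokkerPlanckTorus.flux, hf j x, hp j x, hF.pderiv i j x, hp.pderiv i j x]

end Weight

theorem contDiff_comp_of_hasDerivAt {φ φ' : ℝ → ℝ} {S : Set ℝ}
    (hφ : ∀ y ∈ S, HasDerivAt φ (φ' y) y) (hφ' : ContinuousOn φ' S) (hg : ContDiff ℝ 1 g)
    (hgS : ∀ x, g x ∈ S) : ContDiff ℝ 1 fun x => φ (g x) := by
  have hd : ∀ x, HasFDerivAt (fun x => φ (g x)) (φ' (g x) • fderiv ℝ g x) x := fun x =>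
    (hφ _ (hgS x)).comp_hasFDerivAt x (hg.differentiable one_ne_zero x).hasFDerivAt
  rw [contDiff_one_iff_fderiv]
  refine ⟨fun x => (hd x).differentiableAt, ?_⟩
  rw [funext fun x => (hd x).fderiv]
  exact (hφ'.comp_continuous hg.continuous hgS).smul (hg.continuous_fderiv one_ne_zero)

/-! ### Dissipation of convex functionals -/

namespace IsStrongSolution

variable {ε : ℝ} {f F : (Fin d → ℝ) → ℝ} {ρ : ℝ → (Fin d → ℝ) → ℝ}

theorem continuous_slice (hρ : IsStrongSolution L ε f F ρ) {t : ℝ} (ht : 0 ≤ t) :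
    Continuous (ρ t) :=
  hρ.continuousOn.comp_continuous (f := fun x => (t, x)) (by fun_prop) fun _ => ⟨ht, trivial⟩

theorem continuousOn_relDensity (hρ : IsStrongSolution L ε f F ρ) (hF : Continuous F) :
    ContinuousOn (fun p : ℝ × (Fin d → ℝ) => relDensity ε F (ρ p.1) p.2) (Ici 0 ×ˢ univ) :=
  hρ.continuousOn.mul (Continuous.continuousOn (by fun_prop))

theorem continuousOn_functional (hρ : IsStrongSolution L ε f F ρ) (hF : Continuous F)
    {φ : ℝ → ℝ} {S : Set ℝ} (hφ : ContinuousOn φ S)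
    (hS : ∀ t, 0 ≤ t → ∀ x, relDensity ε F (ρ t) x ∈ S) :
    ContinuousOn (fun t => torusIntegral L
      (fun x => gibbsWeight ε F x * φ (relDensity ε F (ρ t) x))) (Ici 0) := by
  refine continuousOn_torusIntegral (ContinuousOn.mul ?_ ?_)
  · exact ((continuous_gibbsWeight hF).comp continuous_snd).continuousOn
  · exact hφ.comp (hρ.continuousOn_relDensity hF) fun p hp => hS p.1 hp.1 p.2

/-- Since `w ∂ₜh = ∂ₜρ`, the time derivative is the integral of `φ'(h)` times the divergence of the
flux; integrate by parts and insert `flux_eq`. The set `S` allows `φ` that are regular only on the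
range of `h`. -/
theorem hasDerivAt_functional (hL : 0 < L) (hε : ε ≠ 0) (hρ : IsStrongSolution L ε f F ρ)
    (hf_per : IsPeriodic L f) (hF : ContDiff ℝ 1 F) (hF_per : IsPeriodic L F)
    {φ φ' φ'' : ℝ → ℝ} {S : Set ℝ} (hφ : ∀ y ∈ S, HasDerivAt φ (φ' y) y)
    (hφ' : ∀ y ∈ S, HasDerivAt φ' (φ'' y) y) (hφ'' : ContinuousOn φ'' S)
    (hS : ∀ t, 0 ≤ t → ∀ x, relDensity ε F (ρ t) x ∈ S) {t : ℝ} (ht : 0 < t) :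
    HasDerivAt (fun s => torusIntegral L
        (fun x => gibbsWeight ε F x * φ (relDensity ε F (ρ s) x)))
      (-torusIntegral L (fun x => φ'' (relDensity ε F (ρ t) x) *
        (ε * f x * gibbsWeight ε F x * gradSq (relDensity ε F (ρ t)) x))) t := by
  have hφc : ContinuousOn φ S := fun y hy => (hφ y hy).continuousAt.continuousWithinAt
  have hφc' : ContinuousOn φ' S := fun y hy => (hφ' y hy).continuousAt.continuousWithinAt
  have hwc := continuous_gibbsWeight (ε := ε) hF.continuous
  have hHC : ∀ s, 0 < s → ContDiff ℝ 1 (relDensity ε F (ρ s)) := fun s hs =>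
    contDiff_relDensity hF (hρ.contDiff_space s hs)
  have hsub : Ioi (0 : ℝ) ×ˢ (univ : Set (Fin d → ℝ)) ⊆ Ici 0 ×ˢ univ :=
    prod_mono Ioi_subset_Ici_self le_rfl
  have hmain := hasDerivAt_torusIntegral (L := L)
    (Φ := fun s x => gibbsWeight ε F x * φ (relDensity ε F (ρ s) x))
    (Φ' := fun s x => φ' (relDensity ε F (ρ s) x) * deriv (fun r => ρ r x) s)
    (fun s hs => hwc.mul (hφc.comp_continuous (hHC s hs).continuous (hS s hs.le)))
    (fun s hs x => by
      have h1 := (hρ.equation s hs x).differentiableAt.hasDerivAt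
      have h2 : HasDerivAt (fun r => relDensity ε F (ρ r) x)
          (deriv (fun r => ρ r x) s * Real.exp (F x / ε)) s := h1.mul_const _
      have h3 := ((hφ _ (hS s hs.le x)).comp s h2).const_mul (gibbsWeight ε F x)
      refine h3.congr_deriv ?_
      have h4 : gibbsWeight ε F x * Real.exp (F x / ε) = 1 := by
        rw [gibbsWeight, ← Real.exp_add]
        simp
      linear_combination (φ' (relDensity ε F (ρ s) x) * deriv (fun r => ρ r x) s) * h4)
    ((hφc'.comp ((hρ.continuousOn_relDensity hF.continuous).mono hsub)
      fun p hp => hS p.1 (le_of_lt hp.1) p.2).mul hρ.continuousOn_time_deriv) ht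
  refine hmain.congr_deriv ?_
  have hH := hHC t ht
  have hHper : IsPeriodic L (relDensity ε F (ρ t)) := hF_per.relDensity (hρ.periodic t ht.le)
  have hψ : ContDiff ℝ 1 fun x => φ' (relDensity ε F (ρ t) x) :=
    contDiff_comp_of_hasDerivAt hφ' hφ'' hH (hS t ht.le)
  have hJ := hρ.contDiff_flux t ht
  have hJper : ∀ i, IsPeriodic L (flux ε f F (ρ t) i) := fun i =>
    hf_per.flux hF_per (hρ.periodic t ht.le) i
  have h1 : ∀ x, φ' (relDensity ε F (ρ t) x) * deriv (fun r => ρ r x) t =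
      ∑ i, φ' (relDensity ε F (ρ t) x) * pderiv i (flux ε f F (ρ t) i) x := fun x => by
    rw [(hρ.equation t ht x).deriv, Finset.mul_sum]
  have h2 : ∀ x, φ'' (relDensity ε F (ρ t) x) *
        (ε * f x * gibbsWeight ε F x * gradSq (relDensity ε F (ρ t)) x) =
      ∑ i, pderiv i (fun x => φ' (relDensity ε F (ρ t) x)) x * flux ε f F (ρ t) i x := fun x => by
    rw [gradSq, Finset.mul_sum, Finset.mul_sum]
    refine Finset.sum_congr rfl fun i _ => ?_
    rw [pderiv_comp (hφ' _ (hS t ht.le x)) (hH.differentiable one_ne_zero),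
      flux_eq hε (hF.differentiable one_ne_zero)
        ((hρ.contDiff_space t ht).differentiable one_ne_zero)]
    ring
  simp only [h1, h2]
  have hA : ∀ i, Continuous fun x =>
      φ' (relDensity ε F (ρ t) x) * pderiv i (flux ε f F (ρ t) i) x := fun i =>
    hψ.continuous.mul (continuous_pderiv (hJ i) i)
  have hB : ∀ i, Continuous fun x =>
      pderiv i (fun x => φ' (relDensity ε F (ρ t) x)) x * flux ε f F (ρ t) i x := fun i =>
    (continuous_pderiv hψ i).mul (hJ i).continuous
  rw [torusIntegral_sum _ hA, torusIntegral_sum _ hB, ← Finset.sum_neg_distrib]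
  exact Finset.sum_congr rfl fun i _ =>
    torusIntegral_mul_pderiv hL hψ (hHper.comp φ') (hJ i) (hJper i) i

theorem mass_eq_one (hL : 0 < L) (hε : ε ≠ 0) (hρ : IsStrongSolution L ε f F ρ)
    (hf_per : IsPeriodic L f) (hF : ContDiff ℝ 1 F) (hF_per : IsPeriodic L F)
    {t : ℝ} (ht : 0 ≤ t) : torusIntegral L (ρ t) = 1 := by
  have hc := hρ.continuousOn_functional (L := L) hF.continuous (φ := id) (S := univ)
    continuousOn_id fun _ _ _ => trivial
  have hd := fun (s : ℝ) (hs : 0 < s) =>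
    hρ.hasDerivAt_functional hL hε hf_per hF hF_per (φ := id) (φ' := fun _ => 1)
      (φ'' := fun _ => 0) (S := univ) (fun y _ => hasDerivAt_id y)
      (fun y _ => hasDerivAt_const y 1) continuousOn_const (fun _ _ _ => trivial) hs
  simp only [id, gibbsWeight_mul_relDensity, zero_mul] at hc hd
  have h0 : torusIntegral L (fun _ : Fin d → ℝ => (0 : ℝ)) = 0 := by simp [torusIntegral]
  rw [h0, neg_zero] at hd
  have h1 := le_exp_mul_of_deriv_le (κ := 0) hc hd (by simp) ht
  -- Applying monotonicity to the mass and to its negative gives constancy.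
  have h2 := le_exp_mul_of_deriv_le (κ := 0) hc.neg (fun s hs => (hd s hs).neg) (by simp) ht
  have h3 := hρ.init_mass
  simp only [neg_zero, zero_mul, Real.exp_zero, one_mul] at h1 h2
  have h4 : torusIntegral L (ρ t) = torusIntegral L (ρ 0) := le_antisymm h1 (neg_le_neg_iff.1 h2)
  rw [h4, h3]

/-- The convex function `√(y² + η²) - y` dominates `|y| - y` and is at most `η` for `y ≥ 0`. Its
weighted integral does not increase, so `∫ w (|h| - h) ≤ η ∫ w` at all times; let `η → 0`. -/
theorem relDensity_nonneg (hL : 0 < L) (hε : 0 < ε) (hρ : IsStrongSolution L ε f F ρ)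
    (hf_per : IsPeriodic L f) (hf_pos : ∀ x, 0 < f x) (hF : ContDiff ℝ 1 F)
    (hF_per : IsPeriodic L F) {t : ℝ} (ht : 0 ≤ t) (x : Fin d → ℝ) :
    0 ≤ relDensity ε F (ρ t) x := by
  set w := gibbsWeight ε F
  have hwc : Continuous w := continuous_gibbsWeight hF.continuous
  have hw0 : ∀ x, 0 < w x := gibbsWeight_pos
  have hHc : Continuous (relDensity ε F (ρ t)) :=
    (hρ.continuous_slice ht).mul (by have := hF.continuous; fun_prop)
  have key : ∀ η : ℝ, 0 < η → torusIntegral L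
      (fun x => w x * (|relDensity ε F (ρ t) x| - relDensity ε F (ρ t) x)) ≤
        η * torusIntegral L w := by
    intro η hη
    have hroot : ∀ y : ℝ, 0 < √(y ^ 2 + η ^ 2) := fun y => Real.sqrt_pos.2 (by positivity)
    have hsq : ∀ y : ℝ, √(y ^ 2 + η ^ 2) ^ 2 = y ^ 2 + η ^ 2 := fun y =>
      Real.sq_sqrt (by positivity)
    have hr : ∀ y : ℝ, HasDerivAt (fun y => √(y ^ 2 + η ^ 2)) (y / √(y ^ 2 + η ^ 2)) y := by
      intro y
      have h1 : HasDerivAt (fun y : ℝ => y ^ 2 + η ^ 2) (2 * y) y := by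
        simpa using (hasDerivAt_pow 2 y).add_const (η ^ 2)
      refine (h1.sqrt (by positivity)).congr_deriv ?_
      have := hroot y
      field_simp
    set φ : ℝ → ℝ := fun y => √(y ^ 2 + η ^ 2) - y
    set φ' : ℝ → ℝ := fun y => y / √(y ^ 2 + η ^ 2) - 1
    set φ'' : ℝ → ℝ := fun y => η ^ 2 / √(y ^ 2 + η ^ 2) ^ 3
    have hφ : ∀ y ∈ (univ : Set ℝ), HasDerivAt φ (φ' y) y := fun y _ =>
      (hr y).sub (hasDerivAt_id y)
    have hφ' : ∀ y ∈ (univ : Set ℝ), HasDerivAt φ' (φ'' y) y := by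
      intro y _
      refine (((hasDerivAt_id y).div (hr y) (hroot y).ne').sub_const 1).congr_deriv ?_
      have h0 := hroot y
      have h1 := hsq y
      simp only [φ'', id]
      field_simp
      linarith
    have hφ'' : ContinuousOn φ'' univ := by
      refine Continuous.continuousOn (continuous_const.div (by fun_prop) fun y => ?_)
      have := hroot y
      positivity
    have hpos : ∀ y, 0 ≤ φ'' y := fun y => by
      have := hroot y
      simp only [φ'']
      positivity
    have hφc : Continuous φ := by fun_prop
    have hdecay := le_exp_mul_of_deriv_le (κ := 0)
      (hρ.continuousOn_functional (L := L) hF.continuous hφc.continuousOn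
        (S := univ) fun _ _ _ => trivial)
      (fun s hs => hρ.hasDerivAt_functional hL hε.ne' hf_per hF hF_per hφ hφ' hφ''
        (fun _ _ _ => trivial) hs)
      (fun s hs => by
        rw [neg_zero, zero_mul]
        refine neg_nonpos.2 (torusIntegral_nonneg fun x => mul_nonneg (hpos _) ?_)
        exact mul_nonneg (mul_nonneg (mul_nonneg hε.le (hf_pos x).le) (hw0 x).le)
          (gradSq_nonneg _ x)) ht
    rw [neg_zero, zero_mul, Real.exp_zero, one_mul] at hdecay
    have hH0c : Continuous (relDensity ε F (ρ 0)) :=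
      (hρ.continuous_slice le_rfl).mul (by have := hF.continuous; fun_prop)
    refine le_trans (torusIntegral_mono (by fun_prop) (hwc.mul (hφc.comp hHc)) fun x => ?_)
      (hdecay.trans ?_)
    · refine mul_le_mul_of_nonneg_left (sub_le_sub_right ?_ _) (hw0 x).le
      exact Real.abs_le_sqrt (by nlinarith [sq_nonneg η])
    · rw [← torusIntegral_const_mul]
      refine torusIntegral_mono (hwc.mul (hφc.comp hH0c)) (by fun_prop) fun x => ?_
      rw [mul_comm]
      refine mul_le_mul_of_nonneg_right ?_ (hw0 x).le
      have h0 : 0 ≤ relDensity ε F (ρ 0) x := mul_nonneg (hρ.init_nonneg x) (Real.exp_pos _).le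
      have h1 : √(relDensity ε F (ρ 0) x ^ 2 + η ^ 2) ≤ relDensity ε F (ρ 0) x + η := by
        rw [Real.sqrt_le_left (by positivity)]
        nlinarith [mul_nonneg h0 hη.le]
      simp only [φ]
      linarith
  have hnn : ∀ x, 0 ≤ w x * (|relDensity ε F (ρ t) x| - relDensity ε F (ρ t) x) := fun x =>
    mul_nonneg (hw0 x).le (sub_nonneg.2 (le_abs_self _))
  have hzero : torusIntegral L
      (fun x => w x * (|relDensity ε F (ρ t) x| - relDensity ε F (ρ t) x)) = 0 := by
    refine le_antisymm ?_ (torusIntegral_nonneg hnn)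
    have hZ := torusIntegral_pos hL hwc hw0
    refine le_of_forall_pos_le_add fun η hη => ?_
    have := key (η / torusIntegral L w) (by positivity)
    rwa [div_mul_cancel₀ _ hZ.ne', ← zero_add η] at this
  have hper : IsPeriodic L (relDensity ε F (ρ t)) := hF_per.relDensity (hρ.periodic t ht)
  obtain ⟨y, hy, hyx⟩ := hper.exists_mem_cell hL x
  have h1 := eq_zero_on_cell_of_torusIntegral_eq_zero hL (by fun_prop) hnn hzero y hy
  have h2 := (mul_eq_zero.1 h1).resolve_left (hw0 y).ne'
  rw [← hyx, ← sub_eq_zero.1 h2]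
  exact abs_nonneg _

end IsStrongSolution

/-! ### Constants attached to the Gibbs weight -/

section Constants

variable {ε : ℝ} {f F : (Fin d → ℝ) → ℝ}

theorem iInf_eq_of_forall_le {y : Fin d → ℝ} (hy : ∀ x, g y ≤ g x) : ⨅ x, g x = g y :=
  le_antisymm (ciInf_le ⟨g y, by rintro _ ⟨x, rfl⟩; exact hy x⟩ y) (le_ciInf hy)

theorem iSup_eq_of_forall_le {y : Fin d → ℝ} (hy : ∀ x, g x ≤ g y) : ⨆ x, g x = g y :=
  le_antisymm (ciSup_le hy) (le_ciSup ⟨g y, by rintro _ ⟨x, rfl⟩; exact hy x⟩ y)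

theorem exists_Dmax_eq (hL : 0 < L) (hF : Continuous F) (hF_per : IsPeriodic L F) :
    ∃ y, Dmax ε F = Real.exp (F y / ε) ∧ ∀ x, Real.exp (F x / ε) ≤ Real.exp (F y / ε) := by
  obtain ⟨y, hy⟩ := (hF_per.comp fun r => -Real.exp (r / ε)).exists_forall_le hL (by fun_prop)
  have hy' : ∀ x, Real.exp (F x / ε) ≤ Real.exp (F y / ε) := fun x => by simpa using hy x
  exact ⟨y, iSup_eq_of_forall_le (g := fun x => Real.exp (F x / ε)) hy', hy'⟩

theorem exists_Dmin_eq (hL : 0 < L) (hF : Continuous F) (hF_per : IsPeriodic L F) :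
    ∃ y, Dmin ε F = Real.exp (F y / ε) ∧ ∀ x, Real.exp (F y / ε) ≤ Real.exp (F x / ε) := by
  obtain ⟨y, hy⟩ := (hF_per.comp fun r => Real.exp (r / ε)).exists_forall_le hL (by fun_prop)
  exact ⟨y, iInf_eq_of_forall_le (g := fun x => Real.exp (F x / ε)) hy, hy⟩

theorem lambdaEps_pos_and_exists_bound (hL : 0 < L) (hε : 0 < ε) (hf : Continuous f)
    (hf_per : IsPeriodic L f) (hf_pos : ∀ x, 0 < f x) (hF : Continuous F)
    (hF_per : IsPeriodic L F) :
    0 < lambdaEps ε f F ∧ ∃ W, (∀ x, gibbsWeight ε F x ≤ W) ∧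
      ∀ x, lambdaEps ε f F * W ≤ ε * f x * gibbsWeight ε F x := by
  obtain ⟨y, hDmin, hy⟩ := exists_Dmin_eq (ε := ε) hL hF hF_per
  obtain ⟨z, hDmax, hz⟩ := exists_Dmax_eq (ε := ε) hL hF hF_per
  obtain ⟨x₀, hx₀⟩ := (hf_per.mul (hF_per.gibbsWeight (ε := ε))).exists_forall_le hL
    (hf.mul (continuous_gibbsWeight hF))
  have hinf : ⨅ x, f x * Real.exp (-(F x / ε)) = f x₀ * gibbsWeight ε F x₀ :=
    iInf_eq_of_forall_le hx₀
  have hm : 0 < f x₀ * gibbsWeight ε F x₀ := mul_pos (hf_pos x₀) (gibbsWeight_pos x₀)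
  have ha : 0 < Real.exp (F y / ε) := Real.exp_pos _
  have hb : 0 < Real.exp (F z / ε) := Real.exp_pos _
  unfold lambdaEps
  rw [hDmin, hDmax, hinf]
  -- `W = 1 / D_min`, so that `λ_ε W = ε (D_min / D_max) min (f w)`, where the ratio is at most 1.
  refine ⟨by positivity, (Real.exp (F y / ε))⁻¹, fun x => ?_, fun x => ?_⟩
  · rw [gibbsWeight, Real.exp_neg]
    exact inv_anti₀ ha (hy x)
  · have h1 : ε * Real.exp (F y / ε) ^ 2 / Real.exp (F z / ε) *
        (f x₀ * gibbsWeight ε F x₀) * (Real.exp (F y / ε))⁻¹ =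
        ε * (f x₀ * gibbsWeight ε F x₀) * (Real.exp (F y / ε) / Real.exp (F z / ε)) := by
      field_simp
    have h2 : Real.exp (F y / ε) / Real.exp (F z / ε) ≤ 1 := (div_le_one hb).2 (hy z)
    rw [h1, mul_assoc ε (f x)]
    refine (mul_le_of_le_one_right (by positivity) h2).trans ?_
    exact mul_le_mul_of_nonneg_left (hx₀ x) hε.le

theorem gibbsZ_pos (hL : 0 < L) (hF : Continuous F) : 0 < gibbsZ L ε F :=
  torusIntegral_pos hL (continuous_gibbsWeight hF) gibbsWeight_pos

theorem log_Dmax_mul_gibbsZ_nonneg (hL : 1 ≤ L) (hF : Continuous F) (hF_per : IsPeriodic L F) :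
    0 ≤ Real.log (Dmax ε F * gibbsZ L ε F) := by
  have hL0 : 0 < L := one_pos.trans_le hL
  obtain ⟨z, hDmax, hz⟩ := exists_Dmax_eq (ε := ε) hL0 hF hF_per
  refine Real.log_nonneg ((one_le_pow₀ hL).trans (?_ : L ^ d ≤ _))
  rw [hDmax, gibbsZ, ← torusIntegral_const_mul, ← mul_one (L ^ d), ← torusIntegral_const hL0]
  refine torusIntegral_mono continuous_const (by fun_prop) fun x => ?_
  calc (1 : ℝ) = Real.exp (F x / ε) * Real.exp (-(F x / ε)) := by rw [← Real.exp_add]; simp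
    _ ≤ _ := mul_le_mul_of_nonneg_right (hz x) (Real.exp_pos _).le

theorem div_gibbs (hL : 0 < L) (hF : Continuous F) (p : (Fin d → ℝ) → ℝ) (x : Fin d → ℝ) :
    p x / gibbs L ε F x = gibbsZ L ε F * relDensity ε F p x := by
  have := gibbsZ_pos (ε := ε) hL hF
  rw [gibbs, relDensity, Real.exp_neg]
  field_simp

end Constants

/-! ### Exponential decay -/

namespace IsStrongSolution

variable {ε : ℝ} {f F : (Fin d → ℝ) → ℝ} {ρ : ℝ → (Fin d → ℝ) → ℝ}

theorem chiSq_le (hd : 1 ≤ d) (hL : 0 < L) (hε : 0 < ε) (hρ : IsStrongSolution L ε f F ρ)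
    (hf : Continuous f) (hf_per : IsPeriodic L f) (hf_pos : ∀ x, 0 < f x) (hF : ContDiff ℝ 1 F)
    (hF_per : IsPeriodic L F) {t : ℝ} (ht : 0 ≤ t) :
    chiSq L (ρ t) (gibbs L ε F) ≤
      Real.exp (-2 * lambda1 L ε f F * t) * chiSq L (ρ 0) (gibbs L ε F) := by
  obtain ⟨hΛ, W, hwW, hΛW⟩ :=
    lambdaEps_pos_and_exists_bound hL hε hf hf_per hf_pos hF.continuous hF_per
  have hZ := gibbsZ_pos (ε := ε) hL hF.continuous
  have hCpos := poincareConst_pos hd hL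
  set Z := gibbsZ L ε F
  set Λ := lambdaEps ε f F
  set C := poincareConst d L
  -- Chosen so that `w φ(h)` is the χ² integrand, because `ρ / π_G = Z h`.
  set φ : ℝ → ℝ := fun y => Z⁻¹ * (Z * y - 1) ^ 2
  have hlin : ∀ y : ℝ, HasDerivAt (fun y => Z * y - 1) Z y := fun y => by
    simpa using ((hasDerivAt_id y).const_mul Z).sub_const 1
  have hφ : ∀ y ∈ (univ : Set ℝ), HasDerivAt φ (2 * (Z * y - 1)) y := fun y _ => by
    refine (((hlin y).pow 2).const_mul Z⁻¹).congr_deriv ?_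
    push_cast
    field_simp
  have hφ' : ∀ y ∈ (univ : Set ℝ), HasDerivAt (fun y => 2 * (Z * y - 1)) (2 * Z) y :=
    fun y _ => (hlin y).const_mul 2
  have hchi : ∀ s, chiSq L (ρ s) (gibbs L ε F) =
      torusIntegral L (fun x => gibbsWeight ε F x * φ (relDensity ε F (ρ s) x)) := by
    intro s
    unfold chiSq
    congr 1 with x
    rw [div_gibbs hL hF.continuous]
    simp only [gibbs, φ, gibbsWeight]
    ring
  have hrate : -2 * lambda1 L ε f F * t = -(2 * Λ / C) * t := by
    rw [lambda1]
    ring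
  rw [hrate, hchi, hchi]
  refine le_exp_mul_of_deriv_le
    (hρ.continuousOn_functional hF.continuous (S := univ) (by fun_prop) fun _ _ _ => trivial)
    (fun s hs => hρ.hasDerivAt_functional hL hε.ne' hf_per hF hF_per hφ hφ'
      continuousOn_const (fun _ _ _ => trivial) hs) (fun s hs => ?_) ht
  have hH : ContDiff ℝ 1 (relDensity ε F (ρ s)) :=
    contDiff_relDensity hF (hρ.contDiff_space s hs)
  have hHper : IsPeriodic L (relDensity ε F (ρ s)) := hF_per.relDensity (hρ.periodic s hs.le)
  have hwc := continuous_gibbsWeight (ε := ε) hF.continuous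
  have hHc := hH.continuous
  have hgc := continuous_gradSq hH
  have hmean : torusIntegral L (fun x =>
      gibbsWeight ε F x * (Z * relDensity ε F (ρ s) x - 1)) = 0 := by
    have h1 : ∀ x, gibbsWeight ε F x * (Z * relDensity ε F (ρ s) x - 1) =
        Z * ρ s x - gibbsWeight ε F x := fun x => by
      rw [← gibbsWeight_mul_relDensity (ε := ε) (F := F) (p := ρ s) x]
      ring
    have hρc := hρ.continuous_slice hs.le
    simp only [h1]
    rw [torusIntegral_sub (by fun_prop) hwc, torusIntegral_const_mul,
      hρ.mass_eq_one hL hε.ne' hf_per hF hF_per hs.le, mul_one]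
    exact sub_self _
  have hgrad : gradSq (fun x => Z * relDensity ε F (ρ s) x - 1) =
      fun x => Z ^ 2 * gradSq (relDensity ε F (ρ s)) x :=
    funext fun x => gradSq_comp (hlin _) (hH.differentiable one_ne_zero)
  have hpi := weighted_poincare hL hwc (fun x => (gibbsWeight_pos x).le) hwW
    (poincareInequality_poincareConst hL) (by fun_prop)
    (hHper.comp fun r => Z * r - 1) hmean
  rw [hgrad, torusIntegral_const_mul] at hpi
  have hdiss : Λ * W * torusIntegral L (gradSq (relDensity ε F (ρ s))) ≤
      torusIntegral L (fun x => ε * f x * gibbsWeight ε F x *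
        gradSq (relDensity ε F (ρ s)) x) := by
    rw [← torusIntegral_const_mul]
    exact torusIntegral_mono (by fun_prop) (by fun_prop) fun x =>
      mul_le_mul_of_nonneg_right (hΛW x) (gradSq_nonneg _ x)
  have hE : torusIntegral L (fun x => gibbsWeight ε F x * φ (relDensity ε F (ρ s) x)) =
      Z⁻¹ * torusIntegral L (fun x =>
        gibbsWeight ε F x * (Z * relDensity ε F (ρ s) x - 1) ^ 2) := by
    rw [← torusIntegral_const_mul]
    congr 1 with x
    simp only [φ]
    ring
  set I := torusIntegral L (gradSq (relDensity ε F (ρ s)))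
  rw [hE, torusIntegral_const_mul, neg_mul]
  refine neg_le_neg ?_
  calc 2 * Λ / C * (Z⁻¹ * torusIntegral L (fun x =>
        gibbsWeight ε F x * (Z * relDensity ε F (ρ s) x - 1) ^ 2))
      ≤ 2 * Λ / C * (Z⁻¹ * (W * (C * (Z ^ 2 * I)))) := by gcongr
    _ = 2 * Z * (Λ * W * I) := by field_simp
    _ ≤ _ := by gcongr

/-- The entropy of `relDensity + |δ|` relative to its mean, with respect to the Gibbs weight. -/
def shiftedEntropy (L ε : ℝ) (F p : (Fin d → ℝ) → ℝ) (δ : ℝ) : ℝ :=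
  torusIntegral L fun x => gibbsWeight ε F x * ((relDensity ε F p x + |δ|) *
    Real.log ((relDensity ε F p x + |δ|) / ((gibbsZ L ε F)⁻¹ + |δ|)))

/-- Supplies the limit `δ → 0`. The absolute value in the shift keeps the reference mean positive
for every real `δ`. -/
theorem continuous_shiftedEntropy (hL : 0 < L) (hF : Continuous F) {p : (Fin d → ℝ) → ℝ}
    (hp : Continuous p) : Continuous (shiftedEntropy L ε F p) := by
  have hZ := gibbsZ_pos (ε := ε) hL hF
  have hHc : Continuous (relDensity ε F p) := hp.mul (by fun_prop)
  have hwc := continuous_gibbsWeight (ε := ε) hF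
  have hm : ∀ δ : ℝ, 0 < (gibbsZ L ε F)⁻¹ + |δ| := fun δ => by positivity
  refine continuous_parametric_integral_of_continuous (μ := volume) ?_
    (isCompact_Icc (a := (0 : Fin d → ℝ)) (b := fun _ => L))
  have hr : Continuous fun q : ℝ × (Fin d → ℝ) =>
      (relDensity ε F p q.2 + |q.1|) / ((gibbsZ L ε F)⁻¹ + |q.1|) :=
    Continuous.div (by fun_prop) (by fun_prop) fun q => (hm q.1).ne'
  -- The integrand is rewritten through `r log r`, which is continuous even where `r = 0`.
  have hc : Continuous fun q : ℝ × (Fin d → ℝ) => gibbsWeight ε F q.2 *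
      (((gibbsZ L ε F)⁻¹ + |q.1|) *
        ((relDensity ε F p q.2 + |q.1|) / ((gibbsZ L ε F)⁻¹ + |q.1|) *
        Real.log ((relDensity ε F p q.2 + |q.1|) / ((gibbsZ L ε F)⁻¹ + |q.1|)))) :=
    (hwc.comp continuous_snd).mul
      (Continuous.mul (by fun_prop) (Real.continuous_mul_log.comp hr))
  convert hc using 2 with q
  rw [← mul_assoc ((gibbsZ L ε F)⁻¹ + |q.1|), mul_div_cancel₀ _ (hm q.1).ne']
  rfl

theorem shiftedEntropy_zero (hL : 0 < L) (hF : Continuous F) (p : (Fin d → ℝ) → ℝ) :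
    shiftedEntropy L ε F p 0 = KL L p (gibbs L ε F) := by
  unfold shiftedEntropy KL
  congr 1 with x
  rw [div_gibbs hL hF, abs_zero, add_zero, add_zero, ← mul_assoc, gibbsWeight_mul_relDensity,
    div_inv_eq_mul, mul_comm (relDensity ε F p x)]

/-- The shift makes `h + δ` strictly positive without changing `∇h`, and its `w`-mean stays `Z⁻¹ +
δ` by conservation of mass, so `weighted_logSobolev` applies at each positive time. -/
theorem shiftedEntropy_le (hd : 1 ≤ d) (hL : 0 < L) (hε : 0 < ε)
    (hρ : IsStrongSolution L ε f F ρ) (hf : Continuous f) (hf_per : IsPeriodic L f)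
    (hf_pos : ∀ x, 0 < f x) (hF : ContDiff ℝ 1 F) (hF_per : IsPeriodic L F) {δ : ℝ} (hδ : 0 < δ)
    {t : ℝ} (ht : 0 ≤ t) :
    shiftedEntropy L ε F (ρ t) δ ≤
      Real.exp (-2 * lambda2 L ε f F * t) * shiftedEntropy L ε F (ρ 0) δ := by
  obtain ⟨hΛ, W, hwW, hΛW⟩ :=
    lambdaEps_pos_and_exists_bound hL hε hf hf_per hf_pos hF.continuous hF_per
  have hZ := gibbsZ_pos (ε := ε) hL hF.continuous
  have hCpos := logSobolevConst_pos hd hL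
  set Λ := lambdaEps ε f F
  set C := logSobolevConst d L
  set m := (gibbsZ L ε F)⁻¹ + δ with hmdef
  have hm : 0 < m := by positivity
  set φ : ℝ → ℝ := fun y => (y + δ) * Real.log ((y + δ) / m)
  set φ' : ℝ → ℝ := fun y => Real.log ((y + δ) / m) + 1
  set φ'' : ℝ → ℝ := fun y => (y + δ)⁻¹
  have hpos : ∀ y ∈ Ioi (-δ), 0 < y + δ := fun y hy => by linarith [mem_Ioi.1 hy]
  have hlog : ∀ y ∈ Ioi (-δ), HasDerivAt (fun y => Real.log ((y + δ) / m)) (φ'' y) y := by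
    intro y hy
    have h0 := hpos y hy
    refine ((((hasDerivAt_id y).add_const δ).div_const m).log
      (div_pos h0 hm).ne').congr_deriv ?_
    simp only [φ'', id]
    field_simp
  have hφ : ∀ y ∈ Ioi (-δ), HasDerivAt φ (φ' y) y := by
    intro y hy
    have h0 := hpos y hy
    refine (((hasDerivAt_id y).add_const δ).mul (hlog y hy)).congr_deriv ?_
    simp only [φ', φ'', id]
    field_simp
  have hφ' : ∀ y ∈ Ioi (-δ), HasDerivAt φ' (φ'' y) y := fun y hy => (hlog y hy).add_const 1
  have hφ'' : ContinuousOn φ'' (Ioi (-δ)) :=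
    ContinuousOn.inv₀ (by fun_prop) fun y hy => (hpos y hy).ne'
  have hφc : ContinuousOn φ (Ioi (-δ)) := fun y hy => (hφ y hy).continuousAt.continuousWithinAt
  have hS : ∀ s, 0 ≤ s → ∀ x, relDensity ε F (ρ s) x ∈ Ioi (-δ) := fun s hs x =>
    lt_of_lt_of_le (neg_lt_zero.2 hδ)
      (hρ.relDensity_nonneg hL hε hf_per hf_pos hF hF_per hs x)
  have hent : ∀ s, shiftedEntropy L ε F (ρ s) δ =
      torusIntegral L (fun x => gibbsWeight ε F x * φ (relDensity ε F (ρ s) x)) := fun s => by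
    simp only [shiftedEntropy, abs_of_pos hδ, φ, m]
  have hrate : -2 * lambda2 L ε f F * t = -(2 * Λ / C) * t := by
    rw [lambda2]
    ring
  rw [hrate, hent, hent]
  refine le_exp_mul_of_deriv_le (hρ.continuousOn_functional hF.continuous hφc hS)
    (fun s hs => hρ.hasDerivAt_functional hL hε.ne' hf_per hF hF_per hφ hφ' hφ'' hS hs)
    (fun s hs => ?_) ht
  have hH : ContDiff ℝ 1 (relDensity ε F (ρ s)) :=
    contDiff_relDensity hF (hρ.contDiff_space s hs)
  have hHper : IsPeriodic L (relDensity ε F (ρ s)) := hF_per.relDensity (hρ.periodic s hs.le)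
  have hwc := continuous_gibbsWeight (ε := ε) hF.continuous
  have hHc := hH.continuous
  have hgc := continuous_gradSq hH
  have hgpos : ∀ x, 0 < relDensity ε F (ρ s) x + δ := fun x => hpos _ (hS s hs.le x)
  have hmean : torusIntegral L (fun x => gibbsWeight ε F x * (relDensity ε F (ρ s) x + δ)) =
      m * torusIntegral L (gibbsWeight ε F) := by
    have h1 : ∀ x, gibbsWeight ε F x * (relDensity ε F (ρ s) x + δ) =
        ρ s x + δ * gibbsWeight ε F x := fun x => by
      rw [mul_add, gibbsWeight_mul_relDensity, mul_comm δ]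
    have hρc := hρ.continuous_slice hs.le
    simp only [h1]
    rw [torusIntegral_add hρc (by fun_prop), torusIntegral_const_mul,
      hρ.mass_eq_one hL hε.ne' hf_per hF hF_per hs.le, hmdef, add_mul]
    congr 1
    exact (inv_mul_cancel₀ hZ.ne').symm
  have hgrad : gradSq (fun x => relDensity ε F (ρ s) x + δ) = gradSq (relDensity ε F (ρ s)) := by
    funext x
    have := gradSq_comp (φ := fun r => r + δ)
      ((hasDerivAt_id (relDensity ε F (ρ s) x)).add_const δ) (hH.differentiable one_ne_zero)
    simpa using this
  have hlsi := weighted_logSobolev hL hwc (fun x => (gibbsWeight_pos x).le) hwW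
    (logSobolevInequality_logSobolevConst hL) (by fun_prop)
    (hHper.comp fun r => r + δ) hgpos hm hmean
  rw [hgrad] at hlsi
  have hinv : Continuous fun x => (relDensity ε F (ρ s) x + δ)⁻¹ :=
    Continuous.inv₀ (by fun_prop) fun x => (hgpos x).ne'
  simp only [div_eq_mul_inv (gradSq _ _)] at hlsi
  set I := torusIntegral L (fun x =>
    gradSq (relDensity ε F (ρ s)) x * (relDensity ε F (ρ s) x + δ)⁻¹)
  have hdiss : Λ * W * I ≤
      torusIntegral L (fun x => φ'' (relDensity ε F (ρ s) x) *
        (ε * f x * gibbsWeight ε F x * gradSq (relDensity ε F (ρ s)) x)) := by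
    rw [← torusIntegral_const_mul]
    refine torusIntegral_mono (by fun_prop) (hinv.mul (by fun_prop)) fun x => ?_
    have h1 : 0 ≤ gradSq (relDensity ε F (ρ s)) x * (relDensity ε F (ρ s) x + δ)⁻¹ :=
      mul_nonneg (gradSq_nonneg _ x) (inv_pos.2 (hgpos x)).le
    refine (mul_le_mul_of_nonneg_right (hΛW x) h1).trans (le_of_eq ?_)
    simp only [φ'']
    ring
  rw [neg_mul]
  refine neg_le_neg ?_
  calc 2 * Λ / C * torusIntegral L (fun x => gibbsWeight ε F x * φ (relDensity ε F (ρ s) x))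
      ≤ 2 * Λ / C * (W * (C / 2 * I)) := by gcongr
    _ = Λ * W * I := by field_simp
    _ ≤ _ := hdiss

theorem KL_le (hd : 1 ≤ d) (hL : 0 < L) (hε : 0 < ε) (hρ : IsStrongSolution L ε f F ρ)
    (hf : Continuous f) (hf_per : IsPeriodic L f) (hf_pos : ∀ x, 0 < f x) (hF : ContDiff ℝ 1 F)
    (hF_per : IsPeriodic L F) {t : ℝ} (ht : 0 ≤ t) :
    KL L (ρ t) (gibbs L ε F) ≤
      Real.exp (-2 * lambda2 L ε f F * t) * KL L (ρ 0) (gibbs L ε F) := by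
  rw [← shiftedEntropy_zero hL hF.continuous, ← shiftedEntropy_zero hL hF.continuous]
  have hc : ∀ s, 0 ≤ s → Tendsto (shiftedEntropy L ε F (ρ s)) (𝓝[>] 0)
      (𝓝 (shiftedEntropy L ε F (ρ s) 0)) := fun s hs =>
    ((continuous_shiftedEntropy hL hF.continuous (hρ.continuous_slice hs)).tendsto 0).mono_left
      nhdsWithin_le_nhds
  refine le_of_tendsto_of_tendsto (hc t ht) ((hc 0 le_rfl).const_mul _) ?_
  filter_upwards [self_mem_nhdsWithin] with δ hδ
  exact hρ.shiftedEntropy_le hd hL hε hf hf_per hf_pos hF hF_per hδ ht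

end IsStrongSolution

/-! ### Steady states -/

section SteadyState

variable {ε : ℝ} {f F p : (Fin d → ℝ) → ℝ}

theorem relDensity_gibbs (x : Fin d → ℝ) :
    relDensity ε F (gibbs L ε F) x = (gibbsZ L ε F)⁻¹ := by
  rw [relDensity, gibbs, mul_assoc, ← Real.exp_add]
  simp

theorem isSteadyState_gibbs (hL : 0 < L) (hε : 0 < ε) (hF : ContDiff ℝ 1 F)
    (hF_per : IsPeriodic L F) : IsSteadyState L ε f F (gibbs L ε F) := by
  have hZ := gibbsZ_pos (ε := ε) hL hF.continuous
  have hC : ContDiff ℝ 1 (gibbs L ε F) := by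
    unfold gibbs
    fun_prop
  have hc := hC.continuous
  have hflux : ∀ i, flux ε f F (gibbs L ε F) i = fun _ => 0 := by
    intro i
    funext x
    -- The Gibbs density has constant relative density, so its flux vanishes identically.
    rw [flux_eq hε.ne' (hF.differentiable one_ne_zero) (hC.differentiable one_ne_zero),
      funext relDensity_gibbs]
    simp [pderiv]
  exact
    { periodic := fun _ _ => hF_per.comp fun r => (gibbsZ L ε F)⁻¹ * Real.exp (-(r / ε))
      init_nonneg := fun x => mul_nonneg (inv_pos.2 hZ).le (Real.exp_pos _).le
      init_mass := (torusIntegral_const_mul _ _).trans (inv_mul_cancel₀ hZ.ne')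
      continuousOn := (hc.comp continuous_snd).continuousOn
      contDiff_space := fun _ _ => hC
      contDiff_flux := fun _ _ i => by
        rw [hflux]
        exact contDiff_const
      continuousOn_time_deriv := by
        simp only [deriv_const]
        exact continuousOn_const
      equation := fun t _ x => by
        simp only [hflux, pderiv, fderiv_fun_const, Pi.zero_apply, FunLike.coe_zero,
          Finset.sum_const_zero]
        exact hasDerivAt_const t _ }

theorem IsSteadyState.eq_gibbs (hL : 0 < L) (hF : Continuous F)
    (hF_per : IsPeriodic L F) (hp : IsSteadyState L ε f F p) (hlam : 0 < lambda1 L ε f F)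
    (hchi : chiSq L p (gibbs L ε F) ≤
      Real.exp (-2 * lambda1 L ε f F * 1) * chiSq L p (gibbs L ε F)) : p = gibbs L ε F := by
  have hZ := gibbsZ_pos (ε := ε) hL hF
  have hgpos : ∀ x, 0 < gibbs L ε F x := fun x => mul_pos (inv_pos.2 hZ) (Real.exp_pos _)
  have hgc : Continuous (gibbs L ε F) := by
    unfold gibbs
    fun_prop
  have hpc : Continuous p := IsStrongSolution.continuous_slice hp le_rfl
  have hper : IsPeriodic L p := IsStrongSolution.periodic hp 0 le_rfl
  have hnn : ∀ x, 0 ≤ (p x / gibbs L ε F x - 1) ^ 2 * gibbs L ε F x := fun x =>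
    mul_nonneg (sq_nonneg _) (hgpos x).le
  have hexp : Real.exp (-2 * lambda1 L ε f F * 1) < 1 := Real.exp_lt_one_iff.2 (by linarith)
  have hzero : chiSq L p (gibbs L ε F) = 0 := by
    have h0 : 0 ≤ chiSq L p (gibbs L ε F) := torusIntegral_nonneg hnn
    nlinarith
  have hcont : Continuous fun x => (p x / gibbs L ε F x - 1) ^ 2 * gibbs L ε F x :=
    (((hpc.div hgc fun x => (hgpos x).ne').sub continuous_const).pow 2).mul hgc
  have hratio : IsPeriodic L fun x => p x / gibbs L ε F x := fun i x => by
    simp only [gibbs, hper i x, hF_per i x]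
  funext x
  obtain ⟨y, hy, hyx⟩ := hratio.exists_mem_cell hL x
  have h1 := eq_zero_on_cell_of_torusIntegral_eq_zero hL hcont hnn hzero y hy
  have h2 := pow_eq_zero_iff two_ne_zero |>.1 ((mul_eq_zero.1 h1).resolve_right (hgpos y).ne')
  rw [hyx, sub_eq_zero, div_eq_one_iff_eq (hgpos x).ne'] at h2
  exact h2

end SteadyState

end FokkerPlanckTorus

end

open FokkerPlanckTorus in
theorem theorem1 (d : ℕ) (hd : 1 ≤ d) (L : ℝ) (hL : 0 < L) (ε : ℝ) (hε : 0 < ε)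
    (f F : (Fin d → ℝ) → ℝ)
    (hf : Continuous f) (hf_per : IsPeriodic L f) (hf_pos : ∀ x, 0 < f x)
    (hF : ContDiff ℝ 1 F) (hF_per : IsPeriodic L F) :
    0 < lambda1 L ε f F ∧ 0 < lambda2 L ε f F ∧
    (∀ p : (Fin d → ℝ) → ℝ, IsSteadyState L ε f F p ↔ p = gibbs L ε F) ∧
    ∀ ρ : ℝ → (Fin d → ℝ) → ℝ, IsStrongSolution L ε f F ρ →
      (∀ t : ℝ, 0 ≤ t →
        chiSq L (ρ t) (gibbs L ε F) ≤
          Real.exp (-2 * lambda1 L ε f F * t) * chiSq L (ρ 0) (gibbs L ε F)) ∧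
      (1 ≤ L → ∀ t : ℝ, 0 ≤ t →
        KL L (ρ t) (gibbs L ε F) ≤
          Real.exp (-2 * lambda2 L ε f F * t) *
            (2 * lambda2 L ε f F * t * Real.log (Dmax ε F * gibbsZ L ε F) +
              KL L (ρ 0) (gibbs L ε F))) := by
  have hΛ := (lambdaEps_pos_and_exists_bound hL hε hf hf_per hf_pos hF.continuous hF_per).1
  have h1 : 0 < lambda1 L ε f F := div_pos hΛ (poincareConst_pos hd hL)
  have h2 : 0 < lambda2 L ε f F := div_pos hΛ (logSobolevConst_pos hd hL)
  refine ⟨h1, h2, fun p => ⟨fun hp => ?_, ?_⟩, fun ρ hρ => ⟨fun t ht => ?_, fun hL1 t ht => ?_⟩⟩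
  · exact hp.eq_gibbs hL hF.continuous hF_per h1
      -- Any positive time would do; time 1 gives the strict contraction.
      (IsStrongSolution.chiSq_le hd hL hε hp hf hf_per hf_pos hF hF_per zero_le_one)
  · rintro rfl
    exact isSteadyState_gibbs hL hε hF hF_per
  · exact hρ.chiSq_le hd hL hε hf hf_per hf_pos hF hF_per ht
  · refine (hρ.KL_le hd hL hε hf hf_per hf_pos hF hF_per ht).trans ?_
    -- The additional term only weakens the bound, as `D_max Z_G ≥ L ^ d ≥ 1`.
    refine mul_le_mul_of_nonneg_left (le_add_of_nonneg_left ?_) (Real.exp_pos _).le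
    have := log_Dmax_mul_gibbsZ_nonneg (ε := ε) hL1 hF.continuous hF_per
    positivity
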